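/- Consider the coined discrete-time quantum walk on $\mathbb{Z}$ with Hilbert space $\ell^2(\mathbb{Z})\otimes\mathbb{C}^2$, one step being $U_\Theta=S(\mathbb{1}\otimes C_\Theta)$, where $S=\sum_x |x+1\rangle\langle x|\otimes|0\rangle\langle 0|+|x-1\rangle\langle x|\otimes|1\rangle\langle 1|$ and $$C_\Theta=\begin{pmatrix} e^{i\alpha}\cos\theta & e^{i\beta}\sin\theta\\ -e^{-i\beta}\sin\theta & e^{-i\alpha}\cos\theta\end{pmatrix},\qquad \Theta=(\theta,\alpha,\beta)\in\mathbb{R}^3,\quad \sin\theta>0 .$$ For an initial state $\Psi(0)=\sum_{x,j}c_{x,j}|x\rangle\otimes|j\rangle$ put $\Psi=\Psi_\Theta(t)=U_\Theta^t\Psi(0)$ and let $$\mathcal{F}_{\mu\nu}(t)=4\,\mathrm{Re}\big(\langle\partial_\mu\Psi|\partial_\nu\Psi\rangle-\langle\partial_\mu\Psi|\Psi\rangle\langle\Psi|\partial_\nu\Psi\rangle\big),\qquad \mu,\nu\in\{\theta,\alpha,\beta\},$$ be its quantum Fisher information (QFI) matrix. Only initial states are considered for which the momentum amplitude $\varphi_k=\big(\sum_x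 e^{-ikx}c_{x,j}\big)_{j=0,1}$ (series in $L^2(-\pi,\pi)$) is a unit vector of $\mathbb{C}^2$ for almost every $k$; put $\varrho_0=|\varphi_k\rangle\langle\varphi_k|$. Let $u_k=\mathrm{diag}(e^{-ik},e^{ik})\,C_\Theta$ and $O_\mu=u_k^\dagger\partial_\mu u_k$. For a $2\times2$ matrix $O$ let $|O\rangle\rangle=(\mathrm{Tr}(O\sigma_i))_{i=0,x,y,z}\in\mathbb{C}^4$ with $\sigma_0=\mathbb{1}$ and the Pauli matrices, and let $\langle\langle O|$ be its conjugate transpose. Finally let $\mathcal{A}_k$ be the real $4\times4$ matrix $$\mathcal{A}_k=\begin{pmatrix}1&0\\0&N\,v v^{T}\end{pmatrix},\quad v=\begin{pmatrix}\sin(k-\beta)\\-\cos(k-\beta)\\ \cot\theta\,\sin(k-\alpha)\end{pmatrix},\quad N=\frac{\sin^2\theta}{1-\cos^2\theta\cos^2(k-\alpha)} .$$ Put $$I_{\mu\nu}=\int_{-\pi}^{\pi}\frac{dk}{2\pi}\langle\langle O_\mu|\mathcal{A}_k|O_\nu\rangle\rangle,\qquad D_{\mu\nu}=\Big(\int_{-\pi}^{\pi}\frac{dk}{2\pi}\langle\langle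 O_\mu|\mathcal{A}_k|\varrho_0\rangle\rangle\Big)\Big(\int_{-\pi}^{\pi}\frac{dk}{2\pi}\langle\langle \varrho_0|\mathcal{A}_k|O_\nu\rangle\rangle\Big);$$ $I_{\mu\nu}$ does not depend on the initial state, $D_{\mu\nu}$ does. Then: (1) $I_{\theta\theta}=\dfrac{4\sin\theta}{1+\sin\theta}$, $\;I_{\alpha\alpha}=4(1-\sin\theta)$, and $I_{\mu\nu}=0$ for all $\mu\neq\nu$. (2) For every such initial state the derivatives $\partial_\mu\Psi_\Theta(t)$ exist in norm, and for $\mu\in\{\theta,\alpha\}$ the limit $\lim_{t\to\infty}\mathcal{F}_{\mu\mu}(t)/t^2$ exists and is at most $I_{\mu\mu}$. If $D_{\mu\mu}=0$, the limit equals $I_{\mu\mu}$, i.e. to leading order in $t$ the entry is $4t^2\sin\theta/(1+\sin\theta)$ for $\mu=\theta$ and $4t^2(1-\sin\theta)$ for $\mu=\alpha$. Each of these two values is attained by some such initial state, so each is the maximum of the respective limits. (3) If for some such initial state at least one of the two limits equals its maximum, then $\lim_{t\to\infty}\mathcal{F}_{\mu\nu}(t)/t^2=0$ for all $\mu\neq\nu$,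 i.e. the QFI matrix is diagonal to leading order in $t$. -/

import Mathlib

open Filter MeasureTheory
open scoped Topology Matrix ENNReal

noncomputable section

namespace QuantumWalk

/-- The three real parameters of the coin operator. -/
inductive CoinParam
  | theta
  | alpha
  | beta
  deriving DecidableEq

/-- The coin operator `C_Θ`, in the basis `|0⟩, |1⟩` of the coin space. -/
def coin (Θ : CoinParam → ℝ) : Matrix (Fin 2) (Fin 2) ℂ :=
  !![Complex.exp (Complex.I * Θ .alpha) * Real.cos (Θ .theta),
      Complex.exp (Complex.I * Θ .beta) * Real.sin (Θ .theta);
    -Complex.exp (-(Complex.I * Θ .beta)) * Real.sin (Θ .theta),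
      Complex.exp (-(Complex.I * Θ .alpha)) * Real.cos (Θ .theta)]

/-! ### The walk in position space -/

/-- The Hilbert space `ℋ_p ⊗ ℋ_c` of the walker on the lattice `ℤ` with its coin, realised as
`ℓ²(ℤ × {0, 1})`; the entry at `(x, j)` is the amplitude of `|x⟩ ⊗ |j⟩`. -/
abbrev WalkSpace : Type := lp (fun _ : ℤ × Fin 2 => ℂ) 2

theorem memlp_coin (C : Matrix (Fin 2) (Fin 2) ℂ) (ψ : WalkSpace) :
    Memℓp (E := fun _ : ℤ × Fin 2 => ℂ) (fun p => ∑ j, C p.2 j * ψ (p.1, j)) 2 := by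
  have h2 : (0 : ℝ) < (2 : ℝ≥0∞).toReal := by norm_num
  have key : ∀ j : Fin 2,
      Memℓp (E := fun _ : ℤ × Fin 2 => ℂ) (fun p => C p.2 j * ψ (p.1, j)) 2 := by
    intro j
    apply memℓp_gen
    have h := (lp.memℓp ψ).summable h2
    have hj : Summable fun x : ℤ => ‖ψ (x, j)‖ ^ (2 : ℝ≥0∞).toReal :=
      h.comp_injective (i := fun x : ℤ => (x, j)) (fun a b hab => by simpa using hab)
    have hC : Summable fun i : Fin 2 => ‖C i j‖ ^ (2 : ℝ≥0∞).toReal :=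
      (hasSum_fintype _).summable
    have hm := hj.mul_of_nonneg hC (fun _ => by positivity) (fun _ => by positivity)
    refine hm.congr fun p => ?_
    rw [norm_mul, Real.mul_rpow (norm_nonneg _) (norm_nonneg _), mul_comm]
  have h := (key 0).add (key 1)
  convert h using 1
  funext p
  simp [Fin.sum_univ_two]

/-- `𝟙 ⊗ C`: the matrix `C` acting on the coin. -/
def coinOp (C : Matrix (Fin 2) (Fin 2) ℂ) : WalkSpace →ₗ[ℂ] WalkSpace where
  toFun ψ := ⟨fun p => ∑ j, C p.2 j * ψ (p.1, j), memlp_coin C ψ⟩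
  map_add' ψ χ := by
    ext p
    change ∑ j, C p.2 j * (ψ (p.1, j) + χ (p.1, j))
      = (∑ j, C p.2 j * ψ (p.1, j)) + ∑ j, C p.2 j * χ (p.1, j)
    simp only [mul_add, Finset.sum_add_distrib]
  map_smul' c ψ := by
    ext p
    simp [mul_left_comm, mul_add]

/-- The site from which the conditional shift brings the amplitude at `(x, j)`:
a walker with coin `|0⟩` moves from `x` to `x + 1`, one with coin `|1⟩` from `x` to `x - 1`. -/
def shiftSource (p : ℤ × Fin 2) : ℤ × Fin 2 :=
  (if p.2 = 0 then p.1 - 1 else p.1 + 1, p.2)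

theorem shiftSource_injective : Function.Injective shiftSource := by
  rintro ⟨x, i⟩ ⟨y, j⟩ h
  simp only [shiftSource, Prod.mk.injEq] at h
  obtain ⟨h1, rfl⟩ := h
  split_ifs at h1 <;> simp <;> omega

theorem memlp_shift (ψ : WalkSpace) :
    Memℓp (E := fun _ : ℤ × Fin 2 => ℂ) (fun p => ψ (shiftSource p)) 2 := by
  apply memℓp_gen
  exact ((lp.memℓp ψ).summable (by norm_num)).comp_injective shiftSource_injective

/-- The conditional shift
`S = ∑ₓ |x + 1⟩⟨x| ⊗ |0⟩⟨0| + |x - 1⟩⟨x| ⊗ |1⟩⟨1|`. -/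
def shift : WalkSpace →ₗ[ℂ] WalkSpace where
  toFun ψ := ⟨fun p => ψ (shiftSource p), memlp_shift ψ⟩
  map_add' _ _ := rfl
  map_smul' _ _ := rfl

/-- One step of the walk, `U_Θ = S (𝟙 ⊗ C_Θ)`. -/
def walkStep (Θ : CoinParam → ℝ) : WalkSpace →ₗ[ℂ] WalkSpace :=
  shift ∘ₗ coinOp (coin Θ)

/-- The state `Ψ_Θ(t) = U_Θ ^ t Ψ(0)`. -/
def walkState (Ψ₀ : WalkSpace) (t : ℕ) (Θ : CoinParam → ℝ) : WalkSpace :=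
  (walkStep Θ ^ t) Ψ₀

/-- The curve obtained from `Ψ_Θ(t)` by varying only the parameter `μ`. -/
def walkCurve (Ψ₀ : WalkSpace) (t : ℕ) (Θ : CoinParam → ℝ) (μ : CoinParam) (s : ℝ) :
    WalkSpace :=
  walkState Ψ₀ t (Function.update Θ μ s)

/-- The partial derivative `∂_μ Ψ_Θ(t)`, in the norm of the Hilbert space. -/
def walkDeriv (Ψ₀ : WalkSpace) (t : ℕ) (Θ : CoinParam → ℝ) (μ : CoinParam) : WalkSpace :=
  deriv (walkCurve Ψ₀ t Θ μ) (Θ μ)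

/-- The quantum Fisher information matrix of the pure state `Ψ_Θ(t)`:
`4 Re (⟨∂_μ Ψ | ∂_ν Ψ⟩ - ⟨∂_μ Ψ | Ψ⟩ ⟨Ψ | ∂_ν Ψ⟩)`. -/
def qfim (Ψ₀ : WalkSpace) (t : ℕ) (Θ : CoinParam → ℝ) : Matrix CoinParam CoinParam ℝ :=
  fun μ ν =>
    4 * (inner ℂ (walkDeriv Ψ₀ t Θ μ) (walkDeriv Ψ₀ t Θ ν)
      - inner ℂ (walkDeriv Ψ₀ t Θ μ) (walkState Ψ₀ t Θ)
        * inner ℂ (walkState Ψ₀ t Θ) (walkDeriv Ψ₀ t Θ ν)).re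

/-- `L` is the coefficient of `t²` in the large-time behaviour of the entry `(μ, ν)` of the
quantum Fisher information matrix: `ℱ_{μν}(t) = L t² + o(t²)`. -/
def HasLeadingQFI (Ψ₀ : WalkSpace) (Θ : CoinParam → ℝ) (μ ν : CoinParam) (L : ℝ) : Prop :=
  Tendsto (fun t : ℕ => qfim Ψ₀ t Θ μ ν / (t : ℝ) ^ 2) atTop (𝓝 L)

/-! ### The walk in momentum space -/

instance fact_two_pi_pos : Fact (0 < 2 * Real.pi) := ⟨Real.two_pi_pos⟩

/-- The `j`-th coin component of `φ_k(0) = ⟨k | Ψ(0)⟩`, that is the function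
`k ↦ ∑ₓ e^{-ikx} c_{x,j}(0)`; the series converges in `L²(ℝ / 2πℤ)`. -/
def momentumLp (Ψ₀ : WalkSpace) (j : Fin 2) :
    Lp ℂ 2 (AddCircle.haarAddCircle (T := 2 * Real.pi)) :=
  ∑' x : ℤ, Ψ₀ (x, j) • fourierLp 2 (-x)

/-- The amplitude `φ_k(0)` of the initial state at the momentum `k`. -/
def momentumAmp (Ψ₀ : WalkSpace) (k : ℝ) (j : Fin 2) : ℂ :=
  momentumLp Ψ₀ j (k : AddCircle (2 * Real.pi))

/-- For almost every momentum `k` the vector `φ_k(0)` is a unit vector of the coin space, i.e.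
`ϱ₀ = |φ_k(0)⟩⟨φ_k(0)|` is a density matrix. -/
def HasUnitMomentumAmp (Ψ₀ : WalkSpace) : Prop :=
  ∀ᵐ k ∂(volume.restrict (Set.Icc (-Real.pi) Real.pi)), ∑ j, ‖momentumAmp Ψ₀ k j‖ ^ 2 = 1

/-- The evolution in momentum space,
`u_k(Θ) = (e^{-ik} |0⟩⟨0| + e^{ik} |1⟩⟨1|) C_Θ`. -/
def momentumStep (k : ℝ) (Θ : CoinParam → ℝ) : Matrix (Fin 2) (Fin 2) ℂ :=
  !![Complex.exp (-(Complex.I * k)), 0; 0, Complex.exp (Complex.I * k)] * coin Θ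

/-- The entrywise partial derivative `∂_μ u_k`. -/
def momentumStepDeriv (k : ℝ) (Θ : CoinParam → ℝ) (μ : CoinParam) : Matrix (Fin 2) (Fin 2) ℂ :=
  Matrix.of fun i j => deriv (fun s : ℝ => momentumStep k (Function.update Θ μ s) i j) (Θ μ)

/-- The operator `O_μ = u_k† ∂_μ u_k`. -/
def genO (k : ℝ) (Θ : CoinParam → ℝ) (μ : CoinParam) : Matrix (Fin 2) (Fin 2) ℂ :=
  (momentumStep k Θ)ᴴ * momentumStepDeriv k Θ μ

/-- The initial operator `ϱ₀ = |φ_k(0)⟩⟨φ_k(0)|` on the coin space. -/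
def initialRho (Ψ₀ : WalkSpace) (k : ℝ) : Matrix (Fin 2) (Fin 2) ℂ :=
  Matrix.vecMulVec (momentumAmp Ψ₀ k) (star (momentumAmp Ψ₀ k))

/-- The matrices `σ₀ = 𝟙, σ_x, σ_y, σ_z`. -/
def pauli : Fin 4 → Matrix (Fin 2) (Fin 2) ℂ :=
  ![1, !![0, 1; 1, 0], !![0, -Complex.I; Complex.I, 0], !![1, 0; 0, -1]]

/-- The four-dimensional vector `|O⟩⟩` with the entries `Tr (O σ_i)`. -/
def blochVec (O : Matrix (Fin 2) (Fin 2) ℂ) : Fin 4 → ℂ := fun i => (O * pauli i).trace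

/-- The factor `N = sin² θ / (1 - cos² θ cos² (k - α))`. -/
def normN (k : ℝ) (Θ : CoinParam → ℝ) : ℝ :=
  Real.sin (Θ .theta) ^ 2
    / (1 - Real.cos (Θ .theta) ^ 2 * Real.cos (k - Θ .alpha) ^ 2)

/-- The matrix `𝒜_k^𝟙`. -/
def projA (k : ℝ) (Θ : CoinParam → ℝ) : Matrix (Fin 4) (Fin 4) ℝ :=
  let N := normN k Θ
  let ct := Real.cot (Θ .theta)
  let sb := Real.sin (k - Θ .beta)
  let cb := Real.cos (k - Θ .beta)
  let sa := Real.sin (k - Θ .alpha)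
  N • !![1 / N, 0, 0, 0;
         0, sb ^ 2, -(cb * sb), ct * sb * sa;
         0, -(cb * sb), cb ^ 2, -(ct * cb * sa);
         0, ct * sb * sa, -(ct * cb * sa), ct ^ 2 * sa ^ 2]

/-- The sesquilinear form `⟨⟨v| 𝒜_k^𝟙 |w⟩⟩`. -/
def sandwichA (k : ℝ) (Θ : CoinParam → ℝ) (v w : Fin 4 → ℂ) : ℂ :=
  star v ⬝ᵥ ((projA k Θ).map Complex.ofReal *ᵥ w)

/-- The initial-state independent integral `∫ dk/2π ⟨⟨O_μ| 𝒜_k^𝟙 |O_ν⟩⟩` over `[-π, π]`. -/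
def independentTerm (Θ : CoinParam → ℝ) (μ ν : CoinParam) : ℂ :=
  (1 / (2 * Real.pi) : ℂ) * ∫ k in (-Real.pi)..Real.pi,
    sandwichA k Θ (blochVec (genO k Θ μ)) (blochVec (genO k Θ ν))

/-- The initial-state dependent term
`(∫ dk/2π ⟨⟨O_μ| 𝒜_k^𝟙 |ϱ₀⟩⟩) (∫ dk/2π ⟨⟨ϱ₀| 𝒜_k^𝟙 |O_ν⟩⟩)` over `[-π, π]`. -/
def dependentTerm (Ψ₀ : WalkSpace) (Θ : CoinParam → ℝ) (μ ν : CoinParam) : ℂ :=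
  ((1 / (2 * Real.pi) : ℂ) * ∫ k in (-Real.pi)..Real.pi,
      sandwichA k Θ (blochVec (genO k Θ μ)) (blochVec (initialRho Ψ₀ k)))
    * ((1 / (2 * Real.pi) : ℂ) * ∫ k in (-Real.pi)..Real.pi,
      sandwichA k Θ (blochVec (initialRho Ψ₀ k)) (blochVec (genO k Θ ν)))

end QuantumWalk

end

noncomputable section

namespace QuantumWalk

/-! In momentum space a step multiplies the coin amplitude by a matrix `u = cos ω + A` in `SU(2)`,
where `cos ω = cos θ cos (k - α)` and `A` is anti-Hermitian with `A² = -sin² ω`. The quantity `gap`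
is `sin² ω`; it is at least `sin² θ > 0`, uniformly in `k`.

The derivative `∂_μ u` is the sum of a part `u G_μ` commuting with `u`, where `G_μ` is a real
multiple of `A`, and a commutator `X u - u X` (`su2_deriv_eq`). Over `t` steps the commutators
telescope, so `∂_μ (u ^ t) = u ^ t (t G_μ + O(1))` (`pow_mul_growth_succ`). In inner products the
common factor `u ^ t` cancels, and after division by `t` dominated convergence over `k` gives `lim
ℱ_{μν} / t² = 4 (M_{μν} - m_μ m_ν)` (`hasLeadingQFI`). Here `M_{μν}` is the mean of `∂_μ ω ∂_ν ω`,
and `m_μ` the mean of `∂_μ ω` weighted, up to a common sign, by the polarization of the initial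
state along the rotation axis of `u`.

The spatial block of `𝒜_k` is the orthogonal projector onto that axis, whence `I = 4 M_{μν}` and `D
= 4 m_μ m_ν` (`independentTerm_eq`, `dependentTerm_eq`). The means `M_{μν}` are elementary
integrals, and those involving `β` vanish because `ω` is free of `β`. A diagonal limit is `4 M_{μμ}
- 4 m_μ²`, hence maximal exactly when `m_μ = 0`; a state with Bloch vector orthogonal to the axis at
every `k` achieves this. Since always `m_β = 0`, one vanishing mean among `m_θ`, `m_α` kills every
off-diagonal product. -/

/-! ### Algebra of `SU(2)`: secular and oscillating parts of a derivative. -/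

/-- The matrix with first row `(p, r)` of the form taken by the elements of `SU(2)`. -/
def su2 (p r : ℂ) : Matrix (Fin 2) (Fin 2) ℂ := !![p, r; -star r, star p]

/-- The squared sine `1 - (Re p)²` of the quasi-energy of `su2 p r`. -/
def gap (p : ℂ) : ℝ := 1 - p.re ^ 2

/-- The part of `u† ∂u` that commutes with `u = su2 p r`. -/
def drift (p r dp : ℂ) : Matrix (Fin 2) (Fin 2) ℂ :=
  ((-(dp.re / gap p) : ℝ) : ℂ) • (su2 p r - ((p.re : ℝ) : ℂ) • 1)

/-- A matrix whose commutator with `u = su2 p r` is the oscillating part of `∂u`. -/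
def corrector (p r dp dr : ℂ) : Matrix (Fin 2) (Fin 2) ℂ :=
  ((1 / (4 * gap p) : ℝ) : ℂ) • (su2 p r * su2 dp dr - su2 dp dr * su2 p r)

/-- With `A = u - Re p`, the double commutator with `A` is zero on matrices commuting with `A` and
`-4 gap` on those anticommuting with it. Dividing `[u, ∂u]` by `4 gap` therefore solves for the
anticommuting part of `∂u`; `h'` (tangency to the group) identifies the rest as `u` times a multiple
of `A`. -/
theorem su2_deriv_eq {p r dp dr : ℂ} (h : Complex.normSq p + Complex.normSq r = 1)
    (h' : (star p * dp + star r * dr).re = 0) (hq : gap p ≠ 0) :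
    su2 dp dr = su2 p r * drift p r dp + corrector p r dp dr * su2 p r
      - su2 p r * corrector p r dp dr := by
  -- With the reciprocal of `4 * gap p` named `y`, each entry is a polynomial identity modulo `h`,
  -- `h'` and `hy1`.
  obtain ⟨y, hy⟩ : ∃ y : ℝ, y = 1 / (4 * gap p) := ⟨_, rfl⟩
  have hx : -(dp.re / gap p) = -(4 * y * dp.re) := by rw [hy]; field_simp
  have hy1 : 4 * y * gap p = 1 := by rw [hy]; field_simp
  rw [drift, corrector, hx, ← hy]
  clear hx hy hq
  obtain ⟨a, b⟩ := p
  obtain ⟨c, d⟩ := r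
  obtain ⟨a', b'⟩ := dp
  obtain ⟨c', d'⟩ := dr
  simp only [gap] at hy1
  simp [Complex.normSq_apply] at h h'
  simp only [Matrix.mul_smul, Matrix.smul_mul, Matrix.one_fin_two]
  ext i j
  fin_cases i <;> fin_cases j <;> apply Complex.ext <;>
    simp [su2]
  · linear_combination (-a') * hy1 + y * (-4*a') * h
  · linear_combination (-b') * hy1 + y * ((-4*b') * h + 4 * b * h')
  · linear_combination (-c') * hy1 + y * ((-4*c') * h + 4 * c * h')
  · linear_combination (-d') * hy1 + y * ((-4*d') * h + 4 * d * h')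
  · linear_combination c' * hy1 + y * ((4*c') * h - 4 * c * h')
  · linear_combination (-d') * hy1 + y * ((-4*d') * h + 4 * d * h')
  · linear_combination (-a') * hy1 + y * (-4*a') * h
  · linear_combination b' * hy1 + y * ((4*b') * h - 4 * b * h')

theorem su2_mul_drift_comm (p r dp : ℂ) :
    su2 p r * drift p r dp = drift p r dp * su2 p r := by
  simp [drift, mul_sub, sub_mul]

theorem su2_mem_unitary {p r : ℂ} (h : Complex.normSq p + Complex.normSq r = 1) :
    su2 p r ∈ Matrix.unitaryGroup (Fin 2) ℂ := by
  obtain ⟨a, b⟩ := p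
  obtain ⟨c, d⟩ := r
  simp [Complex.normSq_apply] at h
  rw [Matrix.mem_unitaryGroup_iff]
  ext i j
  fin_cases i <;> fin_cases j <;> apply Complex.ext <;>
    simp [su2, Matrix.mul_apply, Fin.sum_univ_two, Matrix.star_apply] <;>
    first | linear_combination h | ring

/-- By Cayley–Hamilton `A = u - Re p` satisfies `A² = -gap`, and `A` is anti-Hermitian, so `A† A =
gap`. -/
theorem su2_re_add_gap {p r : ℂ} (h : Complex.normSq p + Complex.normSq r = 1)
    (v w : Fin 2 → ℂ) :
    star ((su2 p r - ((p.re : ℝ) : ℂ) • (1 : Matrix (Fin 2) (Fin 2) ℂ)) *ᵥ v) ⬝ᵥ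
      ((su2 p r - ((p.re : ℝ) : ℂ) • (1 : Matrix (Fin 2) (Fin 2) ℂ)) *ᵥ w)
      = (gap p : ℂ) * (star v ⬝ᵥ w) := by
  obtain ⟨a, b⟩ := p
  obtain ⟨c, d⟩ := r
  simp [Complex.normSq_apply] at h
  apply Complex.ext <;>
  simp [su2, gap, Matrix.mulVec, dotProduct, Fin.sum_univ_two, -Complex.ofReal_sub,
    -Complex.ofReal_pow]
  · linear_combination ((v 0).re * (w 0).re + (v 0).im * (w 0).im
      + (v 1).re * (w 1).re + (v 1).im * (w 1).im) * h
  · linear_combination ((v 0).re * (w 0).im - (v 0).im * (w 0).re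
      + (v 1).re * (w 1).im - (v 1).im * (w 1).re) * h

/-- The imaginary part of the expectation of `su2 p r` in the state `v`. -/
def expIm (p r : ℂ) (v : Fin 2 → ℂ) : ℝ := (star v ⬝ᵥ (su2 p r *ᵥ v)).im

theorem star_dotProduct_drift (p r dp : ℂ) (v : Fin 2 → ℂ) :
    star v ⬝ᵥ (drift p r dp *ᵥ v)
      = -Complex.I * ((dp.re / gap p * expIm p r v : ℝ) : ℂ) := by
  rw [drift, Matrix.smul_mulVec, dotProduct_smul]
  -- Removing the Hermitian part `Re p` leaves an anti-Hermitian matrix, whose expectation is purely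
  -- imaginary.
  have : star v ⬝ᵥ ((su2 p r - ((p.re : ℝ) : ℂ) • (1 : Matrix (Fin 2) (Fin 2) ℂ)) *ᵥ v)
      = Complex.I * (expIm p r v : ℂ) := by
    obtain ⟨a, b⟩ := p
    obtain ⟨c, d⟩ := r
    apply Complex.ext <;>
    simp [expIm, su2, Matrix.mulVec, dotProduct, Fin.sum_univ_two] <;> ring
  rw [this]
  push_cast
  simp
  ring

theorem drift_dotProduct_star (p r dp : ℂ) (v : Fin 2 → ℂ) :
    star (drift p r dp *ᵥ v) ⬝ᵥ v
      = Complex.I * ((dp.re / gap p * expIm p r v : ℝ) : ℂ) := by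
  have h := congrArg star (star_dotProduct_drift p r dp v)
  rw [← Matrix.star_dotProduct_star, star_star, dotProduct_comm, dotProduct_comm] at h
  simpa using h

theorem drift_dotProduct_drift {p r : ℂ} (h : Complex.normSq p + Complex.normSq r = 1)
    (hq : gap p ≠ 0) (dp dp' : ℂ) (v : Fin 2 → ℂ) :
    star (drift p r dp *ᵥ v) ⬝ᵥ (drift p r dp' *ᵥ v)
      = ((dp.re * dp'.re / gap p : ℝ) : ℂ) * (star v ⬝ᵥ v) := by
  rw [drift, drift, Matrix.smul_mulVec, Matrix.smul_mulVec, dotProduct_smul, star_smul,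
    smul_dotProduct, su2_re_add_gap h]
  have hq' : (gap p : ℂ) ≠ 0 := by exact_mod_cast hq
  simp
  field_simp

/-! ### The momentum-space step and its parameter derivatives. -/

/-- The first entry of `momentumStep`. -/
def stepP (k : ℝ) (Θ : CoinParam → ℝ) : ℂ :=
  Complex.exp (-(Complex.I * (k - Θ .alpha))) * Real.cos (Θ .theta)

/-- The second entry of `momentumStep`. -/
def stepR (k : ℝ) (Θ : CoinParam → ℝ) : ℂ :=
  Complex.exp (-(Complex.I * (k - Θ .beta))) * Real.sin (Θ .theta)

/-- The partial derivatives of `stepP`. -/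
def stepP' (k : ℝ) (Θ : CoinParam → ℝ) : CoinParam → ℂ
  | .theta => -(Complex.exp (-(Complex.I * (k - Θ .alpha))) * Real.sin (Θ .theta))
  | .alpha => Complex.I * stepP k Θ
  | .beta => 0

/-- The partial derivatives of `stepR`. -/
def stepR' (k : ℝ) (Θ : CoinParam → ℝ) : CoinParam → ℂ
  | .theta => Complex.exp (-(Complex.I * (k - Θ .beta))) * Real.cos (Θ .theta)
  | .alpha => 0
  | .beta => Complex.I * stepR k Θ

theorem star_exp_neg_I_mul (x : ℝ) :
    star (Complex.exp (-(Complex.I * x))) = Complex.exp (Complex.I * x) := by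
  rw [Complex.star_def, ← Complex.exp_conj]
  simp

theorem momentumStep_eq (k : ℝ) (Θ : CoinParam → ℝ) :
    momentumStep k Θ = su2 (stepP k Θ) (stepR k Θ) := by
  have e (x y : ℝ) : star (Complex.exp (-(Complex.I * (x - y)))) =
      Complex.exp (Complex.I * x) * Complex.exp (-(Complex.I * y)) := by
    rw [← Complex.ofReal_sub, star_exp_neg_I_mul, ← Complex.exp_add]
    congr 1; push_cast; ring
  have e' (x y : ℝ) : Complex.exp (-(Complex.I * (x - y))) =
      Complex.exp (-(Complex.I * x)) * Complex.exp (Complex.I * y) := by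
    rw [← Complex.exp_add]
    congr 1; ring
  ext i j
  fin_cases i <;> fin_cases j <;>
    simp only [momentumStep, coin, su2, stepP, stepR, star_mul', e] <;>
    simp [Matrix.mul_apply, Fin.sum_univ_two, e', -Complex.ofReal_cos, -Complex.ofReal_sin] <;> ring

theorem hasDerivAt_stepP (k : ℝ) (Θ : CoinParam → ℝ) (μ : CoinParam) :
    HasDerivAt (fun s : ℝ => stepP k (Function.update Θ μ s)) (stepP' k Θ μ) (Θ μ) := by
  cases μ
  · simp only [stepP, stepP', Function.update_self, ne_eq, reduceCtorEq, not_false_eq_true,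
      Function.update_of_ne]
    rw [← mul_neg _ ((Real.sin (Θ .theta) : ℝ) : ℂ), ← Complex.ofReal_neg]
    exact ((Real.hasDerivAt_cos _).ofReal_comp).const_mul _
  · simp only [stepP, stepP', Function.update_self, ne_eq, reduceCtorEq, not_false_eq_true,
      Function.update_of_ne]
    rw [← mul_assoc]
    refine HasDerivAt.mul_const ?_ _
    have h : HasDerivAt (fun s : ℝ => -(Complex.I * ((k : ℂ) - (s : ℂ)))) Complex.I (Θ .alpha) := by
      have := (((hasDerivAt_id (Θ .alpha)).ofReal_comp.const_sub (k : ℂ)).const_mul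
        Complex.I).fun_neg
      simpa using this
    simpa [mul_comm] using h.cexp
  · simpa [stepP, stepP'] using hasDerivAt_const (Θ .beta) (stepP k Θ)

theorem hasDerivAt_stepR (k : ℝ) (Θ : CoinParam → ℝ) (μ : CoinParam) :
    HasDerivAt (fun s : ℝ => stepR k (Function.update Θ μ s)) (stepR' k Θ μ) (Θ μ) := by
  cases μ
  · simp only [stepR, stepR', Function.update_self, ne_eq, reduceCtorEq, not_false_eq_true,
      Function.update_of_ne]
    exact ((Real.hasDerivAt_sin _).ofReal_comp).const_mul _
  · simpa [stepR, stepR'] using hasDerivAt_const (Θ .alpha) (stepR k Θ)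
  · simp only [stepR, stepR', Function.update_self, ne_eq, reduceCtorEq, not_false_eq_true,
      Function.update_of_ne]
    rw [← mul_assoc]
    refine HasDerivAt.mul_const ?_ _
    have h : HasDerivAt (fun s : ℝ => -(Complex.I * ((k : ℂ) - (s : ℂ)))) Complex.I (Θ .beta) := by
      have := (((hasDerivAt_id (Θ .beta)).ofReal_comp.const_sub (k : ℂ)).const_mul
        Complex.I).fun_neg
      simpa using this
    simpa [mul_comm] using h.cexp

theorem hasDerivAt_momentumStep (k : ℝ) (Θ : CoinParam → ℝ) (μ : CoinParam) (i j : Fin 2) :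
    HasDerivAt (fun s : ℝ => momentumStep k (Function.update Θ μ s) i j)
      (su2 (stepP' k Θ μ) (stepR' k Θ μ) i j) (Θ μ) := by
  simp only [momentumStep_eq]
  fin_cases i <;> fin_cases j
  · exact hasDerivAt_stepP k Θ μ
  · exact hasDerivAt_stepR k Θ μ
  · exact (hasDerivAt_stepR k Θ μ).star.neg
  · exact (hasDerivAt_stepP k Θ μ).star

theorem momentumStepDeriv_eq (k : ℝ) (Θ : CoinParam → ℝ) (μ : CoinParam) :
    momentumStepDeriv k Θ μ = su2 (stepP' k Θ μ) (stepR' k Θ μ) := by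
  ext i j
  exact (hasDerivAt_momentumStep k Θ μ i j).deriv

theorem normSq_exp_neg_I_mul (x : ℝ) : Complex.normSq (Complex.exp (-(Complex.I * x))) = 1 := by
  rw [Complex.normSq_eq_norm_sq, Complex.norm_exp]
  simp

theorem normSq_step (k : ℝ) (Θ : CoinParam → ℝ) :
    Complex.normSq (stepP k Θ) + Complex.normSq (stepR k Θ) = 1 := by
  rw [stepP, stepR, ← Complex.ofReal_sub, ← Complex.ofReal_sub, map_mul, map_mul,
    normSq_exp_neg_I_mul, normSq_exp_neg_I_mul, Complex.normSq_ofReal, Complex.normSq_ofReal]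
  linarith [Real.cos_sq_add_sin_sq (Θ .theta)]

theorem exp_neg_I_mul_eq (x : ℝ) :
    Complex.exp (-(Complex.I * x)) = ⟨Real.cos x, -Real.sin x⟩ := by
  rw [show -(Complex.I * (x : ℂ)) = ((-x : ℝ) : ℂ) * Complex.I by push_cast; ring]
  apply Complex.ext
  · rw [Complex.exp_ofReal_mul_I_re, Real.cos_neg]
  · rw [Complex.exp_ofReal_mul_I_im, Real.sin_neg]

theorem stepP_eq (k : ℝ) (Θ : CoinParam → ℝ) :
    stepP k Θ = ⟨Real.cos (k - Θ .alpha) * Real.cos (Θ .theta),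
      -(Real.sin (k - Θ .alpha) * Real.cos (Θ .theta))⟩ := by
  rw [stepP, ← Complex.ofReal_sub, exp_neg_I_mul_eq]
  apply Complex.ext <;> simp [-Complex.ofReal_cos]

theorem stepR_eq (k : ℝ) (Θ : CoinParam → ℝ) :
    stepR k Θ = ⟨Real.cos (k - Θ .beta) * Real.sin (Θ .theta),
      -(Real.sin (k - Θ .beta) * Real.sin (Θ .theta))⟩ := by
  rw [stepR, ← Complex.ofReal_sub, exp_neg_I_mul_eq]
  apply Complex.ext <;> simp [-Complex.ofReal_sin]

theorem stepP'_theta_eq (k : ℝ) (Θ : CoinParam → ℝ) :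
    stepP' k Θ .theta = ⟨-(Real.cos (k - Θ .alpha) * Real.sin (Θ .theta)),
      Real.sin (k - Θ .alpha) * Real.sin (Θ .theta)⟩ := by
  rw [stepP', ← Complex.ofReal_sub, exp_neg_I_mul_eq]
  apply Complex.ext <;> simp [-Complex.ofReal_sin]

theorem stepR'_theta_eq (k : ℝ) (Θ : CoinParam → ℝ) :
    stepR' k Θ .theta = ⟨Real.cos (k - Θ .beta) * Real.cos (Θ .theta),
      -(Real.sin (k - Θ .beta) * Real.cos (Θ .theta))⟩ := by
  rw [stepR', ← Complex.ofReal_sub, exp_neg_I_mul_eq]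
  apply Complex.ext <;> simp [-Complex.ofReal_cos]

/-- Half the `μ`-derivative of the identity `normSq_step`. -/
theorem step_orthogonal (k : ℝ) (Θ : CoinParam → ℝ) (μ : CoinParam) :
    (star (stepP k Θ) * stepP' k Θ μ + star (stepR k Θ) * stepR' k Θ μ).re = 0 := by
  cases μ
  · rw [stepP_eq, stepR_eq, stepP'_theta_eq, stepR'_theta_eq]
    simp
    linear_combination Real.cos (Θ .theta) * Real.sin (Θ .theta) *
      (Real.cos_sq_add_sin_sq (k - Θ .beta) - Real.cos_sq_add_sin_sq (k - Θ .alpha))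
  · simp [stepP', stepR']; ring
  · simp [stepP', stepR']; ring

theorem gap_stepP (k : ℝ) (Θ : CoinParam → ℝ) :
    gap (stepP k Θ) = 1 - Real.cos (Θ .theta) ^ 2 * Real.cos (k - Θ .alpha) ^ 2 := by
  rw [gap, stepP_eq]; ring

/-- The bound does not depend on `k`: it makes all later estimates uniform over the Brillouin zone.
-/
theorem sin_sq_le_gap (k : ℝ) (Θ : CoinParam → ℝ) :
    Real.sin (Θ .theta) ^ 2 ≤ gap (stepP k Θ) := by
  rw [gap_stepP, Real.sin_sq]
  nlinarith [Real.cos_sq_le_one (k - Θ .alpha), sq_nonneg (Real.cos (Θ .theta))]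

/-! ### Fourier transform between lattice and Brillouin zone. -/

/-- The sequence of Fourier coefficients of `momentumLp Ψ j`. -/
def coeffSeq (Ψ : WalkSpace) (j : Fin 2) : lp (fun _ : ℤ => ℂ) 2 :=
  ⟨fun n => Ψ (-n, j), by
    apply memℓp_gen
    exact ((lp.memℓp Ψ).summable (by norm_num)).comp_injective
      (i := fun n : ℤ => (-n, j)) (fun a b hab => by simpa using hab)⟩

theorem momentumLp_eq (Ψ : WalkSpace) (j : Fin 2) :
    momentumLp Ψ j = (fourierBasis (T := 2 * Real.pi)).repr.symm (coeffSeq Ψ j) := by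
  have h := (fourierBasis (T := 2 * Real.pi)).hasSum_repr_symm (coeffSeq Ψ j)
  rw [coe_fourierBasis] at h
  -- The amplitude at site `x` multiplies `e^{-ikx}`, the Fourier mode of index `-x`, so the series
  -- is reindexed by negation.
  have h2 := (Equiv.neg ℤ).hasSum_iff.mpr h
  rw [momentumLp, ← h2.tsum_eq]
  refine tsum_congr fun x => ?_
  simp [coeffSeq]

theorem fourierCoeff_momentumLp (Ψ : WalkSpace) (j : Fin 2) (n : ℤ) :
    fourierCoeff (momentumLp Ψ j) n = Ψ (-n, j) := by
  rw [← fourierBasis_repr, momentumLp_eq, LinearIsometryEquiv.apply_symm_apply]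
  rfl

theorem momentumLp_add (Φ Ψ : WalkSpace) (j : Fin 2) :
    momentumLp (Φ + Ψ) j = momentumLp Φ j + momentumLp Ψ j := by
  rw [momentumLp_eq, momentumLp_eq, momentumLp_eq, ← map_add]
  rfl

theorem momentumLp_smul (c : ℂ) (Ψ : WalkSpace) (j : Fin 2) :
    momentumLp (c • Ψ) j = c • momentumLp Ψ j := by
  rw [momentumLp_eq, momentumLp_eq, ← map_smul]
  rfl

theorem inner_eq_sum_inner_momentumLp (Φ Ψ : WalkSpace) :
    inner ℂ Φ Ψ = ∑ j, inner ℂ (momentumLp Φ j) (momentumLp Ψ j) := by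
  have hj (j : Fin 2) : HasSum (fun x : ℤ => inner ℂ (Φ (x, j)) (Ψ (x, j)))
      (inner ℂ (momentumLp Φ j) (momentumLp Ψ j)) := by
    rw [momentumLp_eq, momentumLp_eq, LinearIsometryEquiv.inner_map_map]
    have h := (Equiv.neg ℤ).hasSum_iff.mpr (lp.hasSum_inner (𝕜 := ℂ) (coeffSeq Φ j) (coeffSeq Ψ j))
    simpa [coeffSeq, Function.comp_def] using h
  have h := (lp.hasSum_inner (𝕜 := ℂ) Φ Ψ).prod_fiberwise (fun x => hasSum_fintype _)
  exact h.unique (hasSum_sum fun j _ => hj j)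

/-- The restriction of Lebesgue measure to the Brillouin zone `(-π, π]`. -/
abbrev bzMeasure : Measure ℝ := volume.restrict (Set.Ioc (-Real.pi) Real.pi)

/-- Almost-everywhere identities hold on the circle, whereas the integrals run over `(-π, π]`; this
transports the former to the latter. -/
theorem quasiMeasurePreserving_coe :
    Measure.QuasiMeasurePreserving ((↑) : ℝ → AddCircle (2 * Real.pi)) bzMeasure
      AddCircle.haarAddCircle := by
  have h := (AddCircle.measurePreserving_mk (2 * Real.pi) (-Real.pi)).quasiMeasurePreserving
  rw [show -Real.pi + 2 * Real.pi = Real.pi by ring] at h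
  refine h.mono_right ?_
  rw [AddCircle.volume_eq_smul_haarAddCircle]
  exact Measure.smul_absolutelyContinuous

theorem inner_eq_integral (Φ Ψ : WalkSpace) :
    inner ℂ Φ Ψ = (1 / (2 * Real.pi) : ℂ) *
      ∫ k in (-Real.pi)..Real.pi, star (momentumAmp Φ k) ⬝ᵥ momentumAmp Ψ k := by
  rw [inner_eq_sum_inner_momentumLp]
  simp only [L2.inner_def]
  rw [← integral_finsetSum _ fun j _ => L2.integrable_inner _ _,
    AddCircle.integral_haarAddCircle, ← AddCircle.intervalIntegral_preimage (2 * Real.pi) (-Real.pi),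
    show -Real.pi + 2 * Real.pi = Real.pi by ring, Complex.real_smul]
  congr 1
  · push_cast; simp
  · simp [dotProduct, momentumAmp, mul_comm]

theorem momentumAmp_add (Φ Ψ : WalkSpace) :
    ∀ᵐ k ∂bzMeasure, momentumAmp (Φ + Ψ) k = momentumAmp Φ k + momentumAmp Ψ k := by
  have h (j : Fin 2) := quasiMeasurePreserving_coe.ae (Lp.coeFn_add (momentumLp Φ j) (momentumLp Ψ j))
  filter_upwards [h 0, h 1] with k h0 h1
  funext j
  simp only [momentumAmp, momentumLp_add, Pi.add_apply]
  fin_cases j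
  · exact h0
  · exact h1

theorem momentumAmp_smul (c : ℂ) (Ψ : WalkSpace) :
    ∀ᵐ k ∂bzMeasure, momentumAmp (c • Ψ) k = c • momentumAmp Ψ k := by
  have h (j : Fin 2) := quasiMeasurePreserving_coe.ae (Lp.coeFn_smul c (momentumLp Ψ j))
  filter_upwards [h 0, h 1] with k h0 h1
  funext j
  simp only [momentumAmp, momentumLp_smul, Pi.smul_apply]
  fin_cases j
  · exact h0
  · exact h1

theorem aestronglyMeasurable_momentumAmp (Ψ : WalkSpace) (j : Fin 2) :
    AEStronglyMeasurable (fun k => momentumAmp Ψ k j) bzMeasure :=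
  (Lp.aestronglyMeasurable (momentumLp Ψ j)).comp_quasiMeasurePreserving quasiMeasurePreserving_coe

theorem ae_eq_of_fourierCoeff_eq (f : Lp ℂ 2 (AddCircle.haarAddCircle (T := 2 * Real.pi)))
    {g : AddCircle (2 * Real.pi) → ℂ} (hg : MemLp g 2 AddCircle.haarAddCircle)
    (h : ∀ n, fourierCoeff f n = fourierCoeff g n) : f =ᵐ[AddCircle.haarAddCircle] g := by
  have : f = hg.toLp g := by
    apply (fourierBasis (T := 2 * Real.pi)).repr.injective
    ext n
    rw [fourierBasis_repr, fourierBasis_repr, h, fourierCoeff_congr_ae hg.coeFn_toLp]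
  rw [this]
  exact hg.coeFn_toLp

/-- The coin-controlled displacement: a walker at `x` with coin `i` comes from
`x + displacement i`. -/
def displacement (i : Fin 2) : ℤ := if i = 0 then -1 else 1

/-- The operator `S (𝟙 ⊗ C)`. -/
def walkOp (C : Matrix (Fin 2) (Fin 2) ℂ) : WalkSpace →ₗ[ℂ] WalkSpace := shift ∘ₗ coinOp C

theorem walkOp_apply (C : Matrix (Fin 2) (Fin 2) ℂ) (Ψ : WalkSpace) (x : ℤ) (i : Fin 2) :
    walkOp C Ψ (x, i) = ∑ j, C i j * Ψ (x + displacement i, j) := by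
  change ∑ j, C i j * Ψ ((shiftSource (x, i)).1, j) = _
  have : (shiftSource (x, i)).1 = x + displacement i := by
    simp only [shiftSource, displacement]; split_ifs <;> ring
  rw [this]

theorem fourierCoeff_fourier_mul (m n : ℤ) (f : AddCircle (2 * Real.pi) → ℂ) :
    fourierCoeff (fun a => fourier m a * f a) n = fourierCoeff f (n - m) := by
  refine integral_congr_ae (Eventually.of_forall fun a => ?_)
  simp only [smul_eq_mul]
  rw [← mul_assoc, ← fourier_add, neg_sub, sub_eq_neg_add]

/-- Both sides are square integrable, so it suffices to compare Fourier coefficients; multiplication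
by a character translates them, which is the conditional shift. -/
theorem momentumLp_walkOp (C : Matrix (Fin 2) (Fin 2) ℂ) (Ψ : WalkSpace) (i : Fin 2) :
    momentumLp (walkOp C Ψ) i =ᵐ[AddCircle.haarAddCircle]
      fun a => fourier (displacement i) a * ∑ j, C i j * momentumLp Ψ j a := by
  have hs : MemLp (fun a => ∑ j, C i j * momentumLp Ψ j a) 2
      (AddCircle.haarAddCircle (T := 2 * Real.pi)) :=
    memLp_finsetSum _ fun j _ => (Lp.memLp (momentumLp Ψ j)).const_mul (C i j)
  refine ae_eq_of_fourierCoeff_eq _ ?_ fun n => ?_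
  · refine hs.of_le ((map_continuous (fourier (displacement i))).aestronglyMeasurable.mul
      hs.aestronglyMeasurable) (Eventually.of_forall fun a => ?_)
    rw [norm_mul, fourier_apply, Circle.norm_coe, one_mul]
  · have hint (j : Fin 2) : Integrable (fun a => C i j * momentumLp Ψ j a)
        (AddCircle.haarAddCircle (T := 2 * Real.pi)) :=
      ((Lp.memLp (momentumLp Ψ j)).const_mul (C i j)).integrable (by norm_num)
    rw [fourierCoeff_fourier_mul, fourierCoeff_momentumLp, walkOp_apply]
    have e : (fun a => ∑ j, C i j * momentumLp Ψ j a)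
        = ∑ j, fun a => C i j * momentumLp Ψ j a := by
      funext a
      rw [Finset.sum_apply]
    rw [e, fourierCoeff.sum]
    · simp only [Finset.sum_apply, fourierCoeff.const_mul, fourierCoeff_momentumLp]
      rw [neg_sub, sub_eq_neg_add]
    · exact fun j _ => hint j

/-- The Fourier multiplier `diag (e^{-ik}, e^{ik})` of the conditional shift. -/
def shiftSymbol (k : ℝ) : Matrix (Fin 2) (Fin 2) ℂ :=
  !![Complex.exp (-(Complex.I * k)), 0; 0, Complex.exp (Complex.I * k)]

theorem fourier_coe_two_pi (m : ℤ) (k : ℝ) :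
    fourier m (k : AddCircle (2 * Real.pi)) = Complex.exp (Complex.I * (m * k)) := by
  rw [fourier_coe_apply]
  congr 1
  have : (Real.pi : ℂ) ≠ 0 := by exact_mod_cast Real.pi_ne_zero
  push_cast
  field_simp

theorem momentumAmp_walkOp (C : Matrix (Fin 2) (Fin 2) ℂ) (Ψ : WalkSpace) :
    ∀ᵐ k ∂bzMeasure, momentumAmp (walkOp C Ψ) k = (shiftSymbol k * C) *ᵥ momentumAmp Ψ k := by
  have h (j : Fin 2) := quasiMeasurePreserving_coe.ae (momentumLp_walkOp C Ψ j)
  filter_upwards [h 0, h 1] with k h0 h1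
  rw [fourier_coe_two_pi] at h0 h1
  rw [← Matrix.mulVec_mulVec]
  funext j
  fin_cases j
  · refine h0.trans ?_
    simp [shiftSymbol, Matrix.mulVec, dotProduct, Fin.sum_univ_two, momentumAmp, displacement]
  · refine h1.trans ?_
    simp [shiftSymbol, Matrix.mulVec, dotProduct, Fin.sum_univ_two, momentumAmp, displacement]

/-! ### Norm differentiability of a single step. -/

theorem tendsto_walkSpace_apply {u : ℕ → WalkSpace} {x : WalkSpace}
    (h : Tendsto u atTop (𝓝 x)) (p : ℤ × Fin 2) :
    Tendsto (fun n => u n p) atTop (𝓝 (x p)) := by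
  rw [tendsto_iff_norm_sub_tendsto_zero] at h ⊢
  exact squeeze_zero (fun _ => norm_nonneg _)
    (fun n => lp.norm_apply_le_norm two_ne_zero (u n - x) p) h

/-- Closed graph theorem: each entry of the image involves only two entries of the argument, so the
graph is closed under coordinatewise limits. -/
theorem continuous_walkOp (C : Matrix (Fin 2) (Fin 2) ℂ) : Continuous (walkOp C) := by
  refine (walkOp C).continuous_of_seq_closed_graph fun u x y hu hy => ?_
  ext ⟨q, i⟩
  refine tendsto_nhds_unique (tendsto_walkSpace_apply hy (q, i)) ?_
  simp only [Function.comp_apply, walkOp_apply]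
  exact tendsto_finsetSum _ fun j _ => (tendsto_walkSpace_apply hu _).const_mul _

theorem walkOp_add (C D : Matrix (Fin 2) (Fin 2) ℂ) (Ψ : WalkSpace) :
    walkOp (C + D) Ψ = walkOp C Ψ + walkOp D Ψ := by
  ext ⟨q, i⟩
  simp only [lp.coeFn_add, Pi.add_apply, walkOp_apply, Matrix.add_apply, add_mul,
    Finset.sum_add_distrib]

theorem walkOp_smul (c : ℂ) (C : Matrix (Fin 2) (Fin 2) ℂ) (Ψ : WalkSpace) :
    walkOp (c • C) Ψ = c • walkOp C Ψ := by
  ext ⟨q, i⟩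
  simp only [lp.coeFn_smul, Pi.smul_apply, walkOp_apply, Matrix.smul_apply, smul_eq_mul,
    mul_assoc, Finset.mul_sum]

/-- The matrix unit `|i⟩⟨j|` on the coin followed by the shift, as a bounded real-linear map. -/
def walkUnit (i j : Fin 2) : WalkSpace →L[ℝ] WalkSpace :=
  ContinuousLinearMap.restrictScalars ℝ
    (⟨walkOp (Matrix.single i j 1), continuous_walkOp _⟩ : WalkSpace →L[ℂ] WalkSpace)

/-- All parameter dependence sits in four scalar coefficients of fixed bounded operators, so
entrywise derivatives of the coin yield derivatives in norm. -/
theorem walkOp_eq_sum (C : Matrix (Fin 2) (Fin 2) ℂ) (Ψ : WalkSpace) :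
    walkOp C Ψ = ∑ i, ∑ j, C i j • walkUnit i j Ψ := by
  have h (i j : Fin 2) : C i j • walkUnit i j Ψ = walkOp (Matrix.single i j (C i j)) Ψ := by
    rw [show Matrix.single i j (C i j) = C i j • Matrix.single i j 1 by simp, walkOp_smul]
    rfl
  simp only [h, Fin.sum_univ_two, ← walkOp_add]
  congr 2
  conv_lhs => rw [Matrix.matrix_eq_sum_single C]
  simp only [Fin.sum_univ_two]

theorem hasDerivAt_walkOp {C : ℝ → Matrix (Fin 2) (Fin 2) ℂ} {C' : Matrix (Fin 2) (Fin 2) ℂ}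
    {ψ : ℝ → WalkSpace} {ψ' : WalkSpace} {s : ℝ}
    (hC : ∀ i j, HasDerivAt (fun s => C s i j) (C' i j) s) (hψ : HasDerivAt ψ ψ' s) :
    HasDerivAt (fun s => walkOp (C s) (ψ s)) (walkOp C' (ψ s) + walkOp (C s) ψ') s := by
  have h (i j : Fin 2) := (hC i j).fun_smul ((walkUnit i j).hasFDerivAt.comp_hasDerivAt s hψ)
  have h2 := HasDerivAt.fun_sum (u := Finset.univ) fun i _ =>
    HasDerivAt.fun_sum (u := Finset.univ) fun j _ => h i j
  simp only [walkOp_eq_sum]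
  convert! h2 using 1
  simp only [Finset.sum_add_distrib]
  rw [add_comm]
  rfl

theorem momentumStep_eq_shiftSymbol_mul (k : ℝ) (Θ : CoinParam → ℝ) :
    momentumStep k Θ = shiftSymbol k * coin Θ := rfl

theorem momentumStep_zero (Θ : CoinParam → ℝ) : momentumStep 0 Θ = coin Θ := by
  rw [momentumStep_eq_shiftSymbol_mul]
  have : shiftSymbol 0 = 1 := by
    simp [shiftSymbol, Matrix.one_fin_two]
  rw [this, one_mul]

/-- The entrywise partial derivative of the coin operator. -/
def coinDeriv (Θ : CoinParam → ℝ) (μ : CoinParam) : Matrix (Fin 2) (Fin 2) ℂ :=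
  su2 (stepP' 0 Θ μ) (stepR' 0 Θ μ)

/-- The coin is the momentum-space step at `k = 0`. -/
theorem hasDerivAt_coin (Θ : CoinParam → ℝ) (μ : CoinParam) (i j : Fin 2) :
    HasDerivAt (fun s : ℝ => coin (Function.update Θ μ s) i j) (coinDeriv Θ μ i j) (Θ μ) := by
  have h := hasDerivAt_momentumStep 0 Θ μ i j
  simp only [momentumStep_zero] at h
  exact h

theorem shiftSymbol_mul_coinDeriv (k : ℝ) (Θ : CoinParam → ℝ) (μ : CoinParam) :
    shiftSymbol k * coinDeriv Θ μ = su2 (stepP' k Θ μ) (stepR' k Θ μ) := by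
  ext i j
  refine HasDerivAt.unique ?_ (hasDerivAt_momentumStep k Θ μ i j)
  simp only [momentumStep_eq_shiftSymbol_mul, Matrix.mul_apply]
  exact HasDerivAt.fun_sum fun l _ => (hasDerivAt_coin Θ μ l j).const_mul _

theorem walkStep_eq (Θ : CoinParam → ℝ) : walkStep Θ = walkOp (coin Θ) := rfl

theorem walkState_succ (Ψ₀ : WalkSpace) (t : ℕ) (Θ : CoinParam → ℝ) :
    walkState Ψ₀ (t + 1) Θ = walkOp (coin Θ) (walkState Ψ₀ t Θ) := by
  rw [walkState, pow_succ', Module.End.mul_apply, ← walkStep_eq, walkState]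

theorem momentumAmp_walkState (Ψ₀ : WalkSpace) (t : ℕ) (Θ : CoinParam → ℝ) :
    ∀ᵐ k ∂bzMeasure, momentumAmp (walkState Ψ₀ t Θ) k
      = (momentumStep k Θ ^ t) *ᵥ momentumAmp Ψ₀ k := by
  induction t with
  | zero => simp [walkState]
  | succ t ih =>
    rw [walkState_succ]
    filter_upwards [ih, momentumAmp_walkOp (coin Θ) (walkState Ψ₀ t Θ)] with k h1 h2
    rw [h2, h1, Matrix.mulVec_mulVec, pow_succ']
    rfl

/-! ### Linear growth of the derivative in the interaction picture. -/

/-- The matrix carrying `φ_k(0)` to the amplitude of `u_k^{-t} ∂_μ Ψ(t)`. -/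
def growth (k : ℝ) (Θ : CoinParam → ℝ) (μ : CoinParam) (t : ℕ) : Matrix (Fin 2) (Fin 2) ℂ :=
  (t : ℂ) • drift (stepP k Θ) (stepR k Θ) (stepP' k Θ μ)
    + (star (momentumStep k Θ ^ t)
        * corrector (stepP k Θ) (stepR k Θ) (stepP' k Θ μ) (stepR' k Θ μ) * momentumStep k Θ ^ t
      - corrector (stepP k Θ) (stepR k Θ) (stepP' k Θ μ) (stepR' k Θ μ))

theorem momentumStep_mem_unitary (k : ℝ) (Θ : CoinParam → ℝ) :
    momentumStep k Θ ∈ Matrix.unitaryGroup (Fin 2) ℂ := by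
  rw [momentumStep_eq]
  exact su2_mem_unitary (normSq_step k Θ)

theorem gap_stepP_pos {Θ : CoinParam → ℝ} (hΘ : 0 < Real.sin (Θ .theta)) (k : ℝ) :
    0 < gap (stepP k Θ) :=
  (pow_pos hΘ 2).trans_le (sin_sq_le_gap k Θ)

/-- Here `u ^ t * growth` equals `t u ^ t G + X u ^ t - u ^ t X`. Inserting `∂u = u G + X u - u X`
in the product rule, the middle terms `u X u ^ t` cancel, and `G` passes through the powers of `u`.
-/
theorem pow_mul_growth_succ {Θ : CoinParam → ℝ} (hΘ : 0 < Real.sin (Θ .theta)) (k : ℝ)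
    (μ : CoinParam) (t : ℕ) :
    momentumStep k Θ ^ (t + 1) * growth k Θ μ (t + 1)
      = su2 (stepP' k Θ μ) (stepR' k Θ μ) * momentumStep k Θ ^ t
        + momentumStep k Θ * (momentumStep k Θ ^ t * growth k Θ μ t) := by
  have hu (n : ℕ) : momentumStep k Θ ^ n * star (momentumStep k Θ ^ n) = 1 :=
    Matrix.mem_unitaryGroup_iff.mp (pow_mem (momentumStep_mem_unitary k Θ) n)
  have key := su2_deriv_eq (normSq_step k Θ) (step_orthogonal k Θ μ) (gap_stepP_pos hΘ k).ne'
  have comm := su2_mul_drift_comm (stepP k Θ) (stepR k Θ) (stepP' k Θ μ)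
  simp only [growth]
  rw [key]
  rw [← momentumStep_eq] at comm ⊢
  set u := momentumStep k Θ
  set G := drift (stepP k Θ) (stepR k Θ) (stepP' k Θ μ)
  set X := corrector (stepP k Θ) (stepR k Θ) (stepP' k Θ μ) (stepR' k Θ μ)
  have e (n : ℕ) : u ^ n * ((n : ℂ) • G + (star (u ^ n) * X * u ^ n - X))
      = (n : ℂ) • (u ^ n * G) + X * u ^ n - u ^ n * X := by
    rw [mul_add, mul_sub, ← mul_assoc, ← mul_assoc, hu, one_mul, Matrix.mul_smul, add_sub_assoc]
  have hc : u ^ t * G = G * u ^ t := (Commute.pow_left (show Commute u G from comm) t).eq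
  rw [e, e]
  simp only [pow_succ', mul_add, mul_sub, add_mul, sub_mul, mul_assoc, Matrix.mul_smul, hc]
  push_cast
  rw [add_smul, one_smul]
  abel

/-- Existence and momentum amplitude of the derivative go through one induction on `t`: the
derivative is taken in norm on the lattice and only then transformed, so no differentiation of
almost-everywhere classes in `k` is needed. -/
theorem exists_hasDerivAt_walkCurve {Θ : CoinParam → ℝ} (hΘ : 0 < Real.sin (Θ .theta))
    (Ψ₀ : WalkSpace) (t : ℕ) (μ : CoinParam) :
    ∃ d : WalkSpace, HasDerivAt (walkCurve Ψ₀ t Θ μ) d (Θ μ) ∧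
      ∀ᵐ k ∂bzMeasure, momentumAmp d k
        = (momentumStep k Θ ^ t * growth k Θ μ t) *ᵥ momentumAmp Ψ₀ k := by
  induction t with
  | zero =>
    refine ⟨0, ?_, ?_⟩
    · exact hasDerivAt_const (Θ μ) Ψ₀
    · filter_upwards [momentumAmp_smul 0 Ψ₀] with k hk
      rw [zero_smul, zero_smul] at hk
      simp [hk, growth]
  | succ t ih =>
    obtain ⟨d, hd, hk⟩ := ih
    refine ⟨walkOp (coinDeriv Θ μ) (walkCurve Ψ₀ t Θ μ (Θ μ)) + walkOp (coin Θ) d, ?_, ?_⟩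
    · have h := hasDerivAt_walkOp (hasDerivAt_coin Θ μ) hd
      rw [Function.update_eq_self] at h
      refine h.congr_of_eventuallyEq (Eventually.of_forall fun s => ?_)
      exact walkState_succ Ψ₀ t _
    · have hs : walkCurve Ψ₀ t Θ μ (Θ μ) = walkState Ψ₀ t Θ := by
        rw [walkCurve, Function.update_eq_self]
      simp only [hs]
      filter_upwards [hk, momentumAmp_walkState Ψ₀ t Θ, momentumAmp_walkOp (coin Θ) d,
        momentumAmp_walkOp (coinDeriv Θ μ) (walkState Ψ₀ t Θ),
        momentumAmp_add (walkOp (coinDeriv Θ μ) (walkState Ψ₀ t Θ)) (walkOp (coin Θ) d)]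
        with k h1 h2 h3 h4 h5
      rw [h5, h4, h3, h2, h1, pow_mul_growth_succ hΘ, Matrix.add_mulVec,
        ← momentumStep_eq_shiftSymbol_mul, shiftSymbol_mul_coinDeriv, Matrix.mulVec_mulVec,
        Matrix.mulVec_mulVec]

theorem differentiableAt_walkCurve {Θ : CoinParam → ℝ} (hΘ : 0 < Real.sin (Θ .theta))
    (Ψ₀ : WalkSpace) (t : ℕ) (μ : CoinParam) :
    DifferentiableAt ℝ (walkCurve Ψ₀ t Θ μ) (Θ μ) :=
  let ⟨_, hd, _⟩ := exists_hasDerivAt_walkCurve hΘ Ψ₀ t μ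
  hd.differentiableAt

theorem momentumAmp_walkDeriv {Θ : CoinParam → ℝ} (hΘ : 0 < Real.sin (Θ .theta))
    (Ψ₀ : WalkSpace) (t : ℕ) (μ : CoinParam) :
    ∀ᵐ k ∂bzMeasure, momentumAmp (walkDeriv Ψ₀ t Θ μ) k
      = (momentumStep k Θ ^ t * growth k Θ μ t) *ᵥ momentumAmp Ψ₀ k := by
  obtain ⟨d, hd, hk⟩ := exists_hasDerivAt_walkCurve hΘ Ψ₀ t μ
  rwa [walkDeriv, hd.deriv]

/-! ### Uniform bounds and dominated convergence. -/

theorem norm_star_dotProduct_le {v w : Fin 2 → ℂ} {B : ℝ} (hv : ‖v‖ ≤ B) (hw : ‖w‖ ≤ B) :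
    ‖star v ⬝ᵥ w‖ ≤ 2 * B ^ 2 := by
  have h (j : Fin 2) : ‖star v j * w j‖ ≤ B ^ 2 := by
    rw [norm_mul, Pi.star_apply, norm_star, sq]
    exact mul_le_mul ((norm_le_pi_norm v j).trans hv) ((norm_le_pi_norm w j).trans hw)
      (norm_nonneg _) ((norm_nonneg _).trans hv)
  rw [dotProduct, Fin.sum_univ_two]
  linarith [norm_add_le (star v 0 * w 0) (star v 1 * w 1), h 0, h 1]

theorem star_mulVec_dotProduct_mulVec {u : Matrix (Fin 2) (Fin 2) ℂ}
    (hu : u ∈ Matrix.unitaryGroup (Fin 2) ℂ) (v w : Fin 2 → ℂ) :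
    star (u *ᵥ v) ⬝ᵥ (u *ᵥ w) = star v ⬝ᵥ w := by
  rw [Matrix.star_mulVec, Matrix.dotProduct_mulVec, Matrix.vecMul_vecMul,
    ← Matrix.star_eq_conjTranspose, Matrix.mem_unitaryGroup_iff'.mp hu, Matrix.vecMul_one]

/-- The powers of `u` have no limit in general, but the same power acts on both vectors and drops
out of the pointwise product; only the convergent vectors `e`, `f` remain, dominated by a constant.
-/
theorem tendsto_inner_of_interaction_picture (Θ : CoinParam → ℝ) {Φ Ξ : ℕ → WalkSpace}
    {e f : ℕ → ℝ → Fin 2 → ℂ} {e' f' : ℝ → Fin 2 → ℂ} {B : ℝ}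
    (hΦ : ∀ t, ∀ᵐ k ∂bzMeasure, momentumAmp (Φ t) k = (momentumStep k Θ ^ t) *ᵥ e t k)
    (hΞ : ∀ t, ∀ᵐ k ∂bzMeasure, momentumAmp (Ξ t) k = (momentumStep k Θ ^ t) *ᵥ f t k)
    (he : ∀ t, ∀ᵐ k ∂bzMeasure, ‖e t k‖ ≤ B) (hf : ∀ t, ∀ᵐ k ∂bzMeasure, ‖f t k‖ ≤ B)
    (he' : ∀ k, Tendsto (fun t => e t k) atTop (𝓝 (e' k)))
    (hf' : ∀ k, Tendsto (fun t => f t k) atTop (𝓝 (f' k))) :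
    Tendsto (fun t => inner ℂ (Φ t) (Ξ t)) atTop
      (𝓝 ((1 / (2 * Real.pi) : ℂ) *
        ∫ k in (-Real.pi)..Real.pi, star (e' k) ⬝ᵥ f' k)) := by
  have hpi : -Real.pi ≤ Real.pi := by linarith [Real.pi_pos]
  have key (t : ℕ) : ∀ᵐ k ∂bzMeasure,
      star (momentumAmp (Φ t) k) ⬝ᵥ momentumAmp (Ξ t) k = star (e t k) ⬝ᵥ f t k := by
    filter_upwards [hΦ t, hΞ t] with k h1 h2
    rw [h1, h2, star_mulVec_dotProduct_mulVec (pow_mem (momentumStep_mem_unitary k Θ) t)]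
  simp only [inner_eq_integral, intervalIntegral.integral_of_le hpi]
  refine Tendsto.const_mul _ ?_
  refine tendsto_integral_of_dominated_convergence (fun _ => 2 * B ^ 2) (fun t => ?_)
    (integrable_const _) (fun t => ?_) ?_
  · simp only [dotProduct, Fin.sum_univ_two, Pi.star_apply]
    have h (j : Fin 2) := (continuous_star.comp_aestronglyMeasurable
      (aestronglyMeasurable_momentumAmp (Φ t) j)).mul (aestronglyMeasurable_momentumAmp (Ξ t) j)
    exact (h 0).add (h 1)
  · filter_upwards [key t, he t, hf t] with k h1 h2 h3
    rw [h1]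
    exact norm_star_dotProduct_le h2 h3
  · filter_upwards [ae_all_iff.mpr key] with k hk
    simp only [hk]
    simp only [dotProduct, Fin.sum_univ_two, Pi.star_apply]
    have h1 (j : Fin 2) := (tendsto_pi_nhds.mp (he' k) j).star
    have h2 (j : Fin 2) := tendsto_pi_nhds.mp (hf' k) j
    exact ((h1 0).mul (h2 0)).add ((h1 1).mul (h2 1))

section MatrixNorm

attribute [local instance] Matrix.linftyOpNormedRing Matrix.linftyOpNormedAlgebra

/-- The matrix norm here is the maximal row sum, compatible with the sup norm on `Fin 2 → ℂ`; the
factor `2` counts the entries of a row. -/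
theorem matrix_norm_le {A : Matrix (Fin 2) (Fin 2) ℂ} {K : ℝ} (h : ∀ i j, ‖A i j‖ ≤ K) :
    ‖A‖ ≤ 2 * K := by
  have hK : 0 ≤ K := (norm_nonneg _).trans (h 0 0)
  rw [Matrix.linfty_opNorm_def]
  lift K to NNReal using hK
  have : (Finset.univ.sup fun i => ∑ j, ‖A i j‖₊) ≤ 2 * K := by
    refine Finset.sup_le fun i _ => ?_
    rw [Fin.sum_univ_two, two_mul]
    exact add_le_add (h i 0) (h i 1)
  exact_mod_cast this

theorem norm_su2_le {p r : ℂ} (hp : ‖p‖ ≤ 1) (hr : ‖r‖ ≤ 1) : ‖su2 p r‖ ≤ 2 := by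
  refine (matrix_norm_le (K := 1) fun i j => ?_).trans_eq (mul_one 2)
  fin_cases i <;> fin_cases j <;> simpa [su2]

theorem norm_unitary_le {u : Matrix (Fin 2) (Fin 2) ℂ}
    (hu : u ∈ Matrix.unitaryGroup (Fin 2) ℂ) : ‖u‖ ≤ 2 :=
  (matrix_norm_le (K := 1) fun i j => entry_norm_bound_of_unitary hu i j).trans_eq (mul_one 2)

theorem norm_exp_neg_I_mul (x y : ℝ) : ‖Complex.exp (-(Complex.I * (x - y)))‖ = 1 := by
  simp [Complex.norm_exp]

theorem norm_stepP_le (k : ℝ) (Θ : CoinParam → ℝ) : ‖stepP k Θ‖ ≤ 1 := by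
  rw [stepP, norm_mul, norm_exp_neg_I_mul, one_mul, Complex.norm_real]
  exact Real.abs_cos_le_one _

theorem norm_stepR_le (k : ℝ) (Θ : CoinParam → ℝ) : ‖stepR k Θ‖ ≤ 1 := by
  rw [stepR, norm_mul, norm_exp_neg_I_mul, one_mul, Complex.norm_real]
  exact Real.abs_sin_le_one _

theorem norm_stepP'_le (k : ℝ) (Θ : CoinParam → ℝ) (μ : CoinParam) : ‖stepP' k Θ μ‖ ≤ 1 := by
  cases μ
  · rw [stepP', norm_neg, norm_mul, norm_exp_neg_I_mul, one_mul, Complex.norm_real]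
    exact Real.abs_sin_le_one _
  · rw [stepP', norm_mul, Complex.norm_I, one_mul]
    exact norm_stepP_le k Θ
  · simp [stepP']

theorem norm_stepR'_le (k : ℝ) (Θ : CoinParam → ℝ) (μ : CoinParam) : ‖stepR' k Θ μ‖ ≤ 1 := by
  cases μ
  · rw [stepR', norm_mul, norm_exp_neg_I_mul, one_mul, Complex.norm_real]
    exact Real.abs_cos_le_one _
  · simp [stepR']
  · rw [stepR', norm_mul, Complex.norm_I, one_mul]
    exact norm_stepR_le k Θ

theorem norm_drift_le {Θ : CoinParam → ℝ} (hΘ : 0 < Real.sin (Θ .theta)) (k : ℝ)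
    (μ : CoinParam) :
    ‖drift (stepP k Θ) (stepR k Θ) (stepP' k Θ μ)‖ ≤ 3 / Real.sin (Θ .theta) ^ 2 := by
  have hs : 0 < Real.sin (Θ .theta) ^ 2 := pow_pos hΘ 2
  have h1 : ‖((-((stepP' k Θ μ).re / gap (stepP k Θ)) : ℝ) : ℂ)‖
      ≤ 1 / Real.sin (Θ .theta) ^ 2 := by
    rw [Complex.norm_real, norm_neg, norm_div, Real.norm_of_nonneg (gap_stepP_pos hΘ k).le]
    exact div_le_div₀ zero_le_one ((Complex.abs_re_le_norm _).trans (norm_stepP'_le k Θ μ)) hs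
      (sin_sq_le_gap k Θ)
  have h2 : ‖(((stepP k Θ).re : ℝ) : ℂ) • (1 : Matrix (Fin 2) (Fin 2) ℂ)‖ ≤ 1 := by
    rw [norm_smul, norm_one, mul_one, Complex.norm_real]
    exact (Complex.abs_re_le_norm _).trans (norm_stepP_le k Θ)
  have h3 := norm_su2_le (norm_stepP_le k Θ) (norm_stepR_le k Θ)
  rw [drift, norm_smul, show 3 / Real.sin (Θ .theta) ^ 2 = 1 / Real.sin (Θ .theta) ^ 2 * 3 by ring]
  exact mul_le_mul h1 ((norm_sub_le _ _).trans (by linarith)) (norm_nonneg _) (by positivity)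

theorem norm_corrector_le {Θ : CoinParam → ℝ} (hΘ : 0 < Real.sin (Θ .theta)) (k : ℝ)
    (μ : CoinParam) :
    ‖corrector (stepP k Θ) (stepR k Θ) (stepP' k Θ μ) (stepR' k Θ μ)‖
      ≤ 2 / Real.sin (Θ .theta) ^ 2 := by
  have hs : 0 < Real.sin (Θ .theta) ^ 2 := pow_pos hΘ 2
  have hg := gap_stepP_pos hΘ k
  have h1 : ‖((1 / (4 * gap (stepP k Θ)) : ℝ) : ℂ)‖ ≤ 1 / (4 * Real.sin (Θ .theta) ^ 2) := by
    rw [Complex.norm_real, Real.norm_of_nonneg (by positivity)]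
    exact one_div_le_one_div_of_le (by positivity)
      (mul_le_mul_of_nonneg_left (sin_sq_le_gap k Θ) (by norm_num))
  have h3 := norm_su2_le (norm_stepP_le k Θ) (norm_stepR_le k Θ)
  have h4 := norm_su2_le (norm_stepP'_le k Θ μ) (norm_stepR'_le k Θ μ)
  have h5 := (norm_mul_le _ _).trans (mul_le_mul h3 h4 (norm_nonneg _) zero_le_two)
  have h6 := (norm_mul_le _ _).trans (mul_le_mul h4 h3 (norm_nonneg _) zero_le_two)
  rw [corrector, norm_smul, show 2 / Real.sin (Θ .theta) ^ 2
    = 1 / (4 * Real.sin (Θ .theta) ^ 2) * 8 by field_simp; norm_num]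
  exact mul_le_mul h1 ((norm_sub_le _ _).trans (by linarith)) (norm_nonneg _) (by positivity)

/-- What remains is a conjugate of the corrector minus the corrector: `2 * (2 / sin² θ) * 2 + 2 /
sin² θ`, independently of `t` and `k`. -/
theorem norm_growth_sub_le {Θ : CoinParam → ℝ} (hΘ : 0 < Real.sin (Θ .theta)) (k : ℝ)
    (μ : CoinParam) (t : ℕ) :
    ‖growth k Θ μ t - (t : ℂ) • drift (stepP k Θ) (stepR k Θ) (stepP' k Θ μ)‖
      ≤ 10 / Real.sin (Θ .theta) ^ 2 := by
  have hX := norm_corrector_le hΘ k μ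
  have hm := pow_mem (momentumStep_mem_unitary k Θ) t
  have h1 := norm_unitary_le hm
  have h2 := norm_unitary_le (Unitary.star_mem hm)
  have hpos : 0 ≤ 2 / Real.sin (Θ .theta) ^ 2 := by positivity
  rw [growth, add_sub_cancel_left]
  have h3 := (norm_mul_le _ _).trans (mul_le_mul h2 hX (norm_nonneg _) zero_le_two)
  have h4 := (norm_mul_le _ _).trans (mul_le_mul h3 h1 (norm_nonneg _) (by positivity))
  refine (norm_sub_le _ _).trans ((add_le_add h4 hX).trans_eq ?_)
  ring

/-- The constant is `3` from the drift plus `10` from the bounded remainder. -/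
theorem norm_inv_smul_growth_le {Θ : CoinParam → ℝ} (hΘ : 0 < Real.sin (Θ .theta)) (k : ℝ)
    (μ : CoinParam) (t : ℕ) :
    ‖(t : ℂ)⁻¹ • growth k Θ μ t‖ ≤ 13 / Real.sin (Θ .theta) ^ 2 := by
  -- At `t = 0` the inverse is `0` by convention, so the bound is trivial there.
  rcases Nat.eq_zero_or_pos t with rfl | ht
  · simp; positivity
  have ht1 : (1 : ℝ) ≤ t := by exact_mod_cast ht
  have h1 := norm_growth_sub_le hΘ k μ t
  have h2 := norm_drift_le hΘ k μ
  have h3 : ‖growth k Θ μ t‖ ≤ t * (13 / Real.sin (Θ .theta) ^ 2) := by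
    have h4 := norm_sub_norm_le (growth k Θ μ t)
      ((t : ℂ) • drift (stepP k Θ) (stepR k Θ) (stepP' k Θ μ))
    rw [norm_smul, Complex.norm_natCast] at h4
    have h5 := mul_le_mul_of_nonneg_left h2 (zero_le_one.trans ht1)
    have h6 : 10 / Real.sin (Θ .theta) ^ 2 ≤ t * (10 / Real.sin (Θ .theta) ^ 2) :=
      le_mul_of_one_le_left (by positivity) ht1
    have h7 : t * (13 / Real.sin (Θ .theta) ^ 2)
      = t * (3 / Real.sin (Θ .theta) ^ 2) + t * (10 / Real.sin (Θ .theta) ^ 2) := by ring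
    linarith
  rw [norm_smul, norm_inv, Complex.norm_natCast, inv_mul_le_iff₀ (by positivity)]
  exact h3

theorem tendsto_inv_smul_growth {Θ : CoinParam → ℝ} (hΘ : 0 < Real.sin (Θ .theta)) (k : ℝ)
    (μ : CoinParam) :
    Tendsto (fun t : ℕ => (t : ℂ)⁻¹ • growth k Θ μ t) atTop
      (𝓝 (drift (stepP k Θ) (stepR k Θ) (stepP' k Θ μ))) := by
  refine tendsto_iff_norm_sub_tendsto_zero.mpr ?_
  have h0 : Tendsto (fun t : ℕ => (t : ℝ)⁻¹ * (10 / Real.sin (Θ .theta) ^ 2)) atTop (𝓝 0) := by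
    simpa using (tendsto_inv_atTop_nhds_zero_nat (𝕜 := ℝ)).mul_const
      (10 / Real.sin (Θ .theta) ^ 2)
  refine squeeze_zero' (Eventually.of_forall fun _ => norm_nonneg _) ?_ h0
  filter_upwards [eventually_gt_atTop 0] with t ht
  have ht' : (t : ℂ) ≠ 0 := by exact_mod_cast ht.ne'
  have e : (t : ℂ)⁻¹ • growth k Θ μ t - drift (stepP k Θ) (stepR k Θ) (stepP' k Θ μ)
      = (t : ℂ)⁻¹ • (growth k Θ μ t
        - (t : ℂ) • drift (stepP k Θ) (stepR k Θ) (stepP' k Θ μ)) := by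
    rw [smul_sub, inv_smul_smul₀ ht']
  rw [e, norm_smul, norm_inv, Complex.norm_natCast]
  exact mul_le_mul_of_nonneg_left (norm_growth_sub_le hΘ k μ t) (by positivity)

theorem norm_inv_smul_growth_mulVec_le {Θ : CoinParam → ℝ} (hΘ : 0 < Real.sin (Θ .theta))
    (k : ℝ) (μ : CoinParam) (t : ℕ) {v : Fin 2 → ℂ} (hv : ‖v‖ ≤ 1) :
    ‖((t : ℂ)⁻¹ • growth k Θ μ t) *ᵥ v‖ ≤ 13 / Real.sin (Θ .theta) ^ 2 := by
  have h := (Matrix.linfty_opNorm_mulVec ((t : ℂ)⁻¹ • growth k Θ μ t) v).trans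
    (mul_le_mul (norm_inv_smul_growth_le hΘ k μ t) hv (norm_nonneg _) (by positivity))
  rwa [mul_one] at h

theorem tendsto_inv_smul_growth_mulVec {Θ : CoinParam → ℝ} (hΘ : 0 < Real.sin (Θ .theta))
    (k : ℝ) (μ : CoinParam) (v : Fin 2 → ℂ) :
    Tendsto (fun t : ℕ => ((t : ℂ)⁻¹ • growth k Θ μ t) *ᵥ v) atTop
      (𝓝 (drift (stepP k Θ) (stepR k Θ) (stepP' k Θ μ) *ᵥ v)) :=
  ((continuous_id.matrix_mulVec continuous_const).tendsto _).comp
    (tendsto_inv_smul_growth hΘ k μ)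

end MatrixNorm

/-! ### The leading coefficient of the Fisher information. -/

/-- The mean over the Brillouin zone of `∂_μ ω ∂_ν ω`, for the quasi-energy `ω`. -/
def meanVelocityProd (Θ : CoinParam → ℝ) (μ ν : CoinParam) : ℝ :=
  1 / (2 * Real.pi) * ∫ k in (-Real.pi)..Real.pi,
    (stepP' k Θ μ).re * (stepP' k Θ ν).re / gap (stepP k Θ)

/-- The mean over the Brillouin zone of `∂_μ ω` weighted by the polarization of the initial
state along the rotation axis of the momentum-space evolution. -/
def meanVelocity (Ψ₀ : WalkSpace) (Θ : CoinParam → ℝ) (μ : CoinParam) : ℝ :=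
  1 / (2 * Real.pi) * ∫ k in (-Real.pi)..Real.pi,
    (stepP' k Θ μ).re / gap (stepP k Θ) * expIm (stepP k Θ) (stepR k Θ) (momentumAmp Ψ₀ k)

theorem ae_bzMeasure_of_hasUnitMomentumAmp {Ψ₀ : WalkSpace} (h : HasUnitMomentumAmp Ψ₀) :
    ∀ᵐ k ∂bzMeasure, star (momentumAmp Ψ₀ k) ⬝ᵥ momentumAmp Ψ₀ k = 1 ∧
      ‖momentumAmp Ψ₀ k‖ ≤ 1 := by
  rw [HasUnitMomentumAmp, ← restrict_Ioc_eq_restrict_Icc] at h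
  filter_upwards [h] with k hk
  constructor
  · rw [dotProduct]
    have e (j : Fin 2) : star (momentumAmp Ψ₀ k) j * momentumAmp Ψ₀ k j
        = ((‖momentumAmp Ψ₀ k j‖ ^ 2 : ℝ) : ℂ) := by
      rw [Pi.star_apply, Complex.star_def, Complex.conj_mul']
      push_cast; rfl
    simp only [e]
    rw [← Complex.ofReal_sum, hk, Complex.ofReal_one]
  · rw [pi_norm_le_iff_of_nonneg zero_le_one]
    intro j
    have : ‖momentumAmp Ψ₀ k j‖ ^ 2 ≤ 1 := by
      rw [← hk]
      exact Finset.single_le_sum (f := fun j => ‖momentumAmp Ψ₀ k j‖ ^ 2)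
        (fun _ _ => by positivity) (Finset.mem_univ j)
    exact (sq_le_one_iff₀ (norm_nonneg _)).mp this

theorem qfim_div_sq (Ψ₀ : WalkSpace) (t : ℕ) (Θ : CoinParam → ℝ) (μ ν : CoinParam) :
    qfim Ψ₀ t Θ μ ν / (t : ℝ) ^ 2 =
      4 * (inner ℂ ((t : ℂ)⁻¹ • walkDeriv Ψ₀ t Θ μ) ((t : ℂ)⁻¹ • walkDeriv Ψ₀ t Θ ν)
        - inner ℂ ((t : ℂ)⁻¹ • walkDeriv Ψ₀ t Θ μ) (walkState Ψ₀ t Θ)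
          * inner ℂ (walkState Ψ₀ t Θ) ((t : ℂ)⁻¹ • walkDeriv Ψ₀ t Θ ν)).re := by
  have hc : (starRingEnd ℂ) (t : ℂ)⁻¹ = (t : ℂ)⁻¹ := by simp
  simp only [qfim, inner_smul_left, inner_smul_right, hc]
  generalize inner ℂ (walkDeriv Ψ₀ t Θ μ) (walkDeriv Ψ₀ t Θ ν) = x
  generalize inner ℂ (walkDeriv Ψ₀ t Θ μ) (walkState Ψ₀ t Θ) = y
  generalize inner ℂ (walkState Ψ₀ t Θ) (walkDeriv Ψ₀ t Θ ν) = z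
  have e : (t : ℂ)⁻¹ * ((t : ℂ)⁻¹ * x) - (t : ℂ)⁻¹ * y * ((t : ℂ)⁻¹ * z)
      = ((((t : ℝ) ^ 2)⁻¹ : ℝ) : ℂ) * (x - y * z) := by
    push_cast; ring
  rw [e, Complex.re_ofReal_mul]
  ring

/-- The limits of the three inner products in `qfim_div_sq` are means of `⟨Gφ, Gφ⟩`, `⟨Gφ, φ⟩` and
`⟨φ, Gφ⟩`. The first is free of the initial state because `A† A` is scalar and `φ_k` is a unit
vector. -/
theorem hasLeadingQFI {Θ : CoinParam → ℝ} (hΘ : 0 < Real.sin (Θ .theta)) {Ψ₀ : WalkSpace}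
    (hΨ : HasUnitMomentumAmp Ψ₀) (μ ν : CoinParam) :
    HasLeadingQFI Ψ₀ Θ μ ν
      (4 * (meanVelocityProd Θ μ ν - meanVelocity Ψ₀ Θ μ * meanVelocity Ψ₀ Θ ν)) := by
  have hpi : -Real.pi ≤ Real.pi := by linarith [Real.pi_pos]
  have hunit := ae_bzMeasure_of_hasUnitMomentumAmp hΨ
  -- This lets one bound `13 / sin² θ` serve for the state as well as for its derivatives.
  have hs1 : (1 : ℝ) ≤ 13 / Real.sin (Θ .theta) ^ 2 := by
    rw [le_div_iff₀ (pow_pos hΘ 2)]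
    linarith [Real.sin_sq_le_one (Θ .theta)]
  have hD (μ : CoinParam) (t : ℕ) : ∀ᵐ k ∂bzMeasure,
      momentumAmp ((t : ℂ)⁻¹ • walkDeriv Ψ₀ t Θ μ) k
        = (momentumStep k Θ ^ t) *ᵥ (((t : ℂ)⁻¹ • growth k Θ μ t) *ᵥ momentumAmp Ψ₀ k) := by
    filter_upwards [momentumAmp_smul (t : ℂ)⁻¹ (walkDeriv Ψ₀ t Θ μ),
      momentumAmp_walkDeriv hΘ Ψ₀ t μ] with k h1 h2
    rw [h1, h2, Matrix.smul_mulVec, Matrix.mulVec_smul, Matrix.mulVec_mulVec]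
  have hB (μ : CoinParam) (t : ℕ) : ∀ᵐ k ∂bzMeasure,
      ‖((t : ℂ)⁻¹ • growth k Θ μ t) *ᵥ momentumAmp Ψ₀ k‖ ≤ 13 / Real.sin (Θ .theta) ^ 2 := by
    filter_upwards [hunit] with k hk
    exact norm_inv_smul_growth_mulVec_le hΘ k μ t hk.2
  have hS : ∀ t : ℕ, ∀ᵐ k ∂bzMeasure, momentumAmp (walkState Ψ₀ t Θ) k
      = (momentumStep k Θ ^ t) *ᵥ momentumAmp Ψ₀ k := fun t => momentumAmp_walkState Ψ₀ t Θ
  have hSB : ∀ t : ℕ, ∀ᵐ k ∂bzMeasure,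
      ‖momentumAmp Ψ₀ k‖ ≤ 13 / Real.sin (Θ .theta) ^ 2 := fun _ => by
    filter_upwards [hunit] with k hk
    exact hk.2.trans hs1
  have hlim (μ : CoinParam) (k : ℝ) := tendsto_inv_smul_growth_mulVec hΘ k μ (momentumAmp Ψ₀ k)
  have hconst (k : ℝ) : Tendsto (fun _ : ℕ => momentumAmp Ψ₀ k) atTop (𝓝 (momentumAmp Ψ₀ k)) :=
    tendsto_const_nhds
  have l1 := tendsto_inner_of_interaction_picture Θ (hD μ) (hD ν) (hB μ) (hB ν) (hlim μ) (hlim ν)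
  have l2 := tendsto_inner_of_interaction_picture Θ (hD μ) hS (hB μ) hSB (hlim μ) hconst
  have l3 := tendsto_inner_of_interaction_picture Θ hS (hD ν) hSB (hB ν) hconst (hlim ν)
  simp only [drift_dotProduct_star, star_dotProduct_drift, intervalIntegral.integral_const_mul,
    intervalIntegral.integral_ofReal] at l2 l3
  have e1 : ∫ k in (-Real.pi)..Real.pi,
      star (drift (stepP k Θ) (stepR k Θ) (stepP' k Θ μ) *ᵥ momentumAmp Ψ₀ k) ⬝ᵥ
        (drift (stepP k Θ) (stepR k Θ) (stepP' k Θ ν) *ᵥ momentumAmp Ψ₀ k)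
      = ((∫ k in (-Real.pi)..Real.pi,
        (stepP' k Θ μ).re * (stepP' k Θ ν).re / gap (stepP k Θ) : ℝ) : ℂ) := by
    rw [← intervalIntegral.integral_ofReal, intervalIntegral.integral_of_le hpi,
      intervalIntegral.integral_of_le hpi]
    refine integral_congr_ae ?_
    filter_upwards [hunit] with k hk
    rw [drift_dotProduct_drift (normSq_step k Θ) (gap_stepP_pos hΘ k).ne', hk.1, mul_one]
  rw [e1] at l1
  have l := ((Complex.continuous_re.tendsto _).comp (l1.sub (l2.mul l3))).const_mul 4
  simp only [HasLeadingQFI, qfim_div_sq]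
  convert! l using 2
  rw [meanVelocityProd, meanVelocity, meanVelocity, ← Complex.ofReal_re (4 * _)]
  generalize (∫ k in (-Real.pi)..Real.pi,
        (stepP' k Θ μ).re * (stepP' k Θ ν).re / gap (stepP k Θ)) = A
  generalize (∫ k in (-Real.pi)..Real.pi, (stepP' k Θ μ).re / gap (stepP k Θ)
    * expIm (stepP k Θ) (stepR k Θ) (momentumAmp Ψ₀ k)) = B
  generalize (∫ k in (-Real.pi)..Real.pi, (stepP' k Θ ν).re / gap (stepP k Θ)
    * expIm (stepP k Θ) (stepR k Θ) (momentumAmp Ψ₀ k)) = C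
  rw [← Complex.re_ofReal_mul]
  congr 1
  push_cast
  -- The two overlaps carry the factors `i` and `-i`, whose product is `1`.
  linear_combination (4 * (1 / (2 * (Real.pi : ℂ)) * B) * (1 / (2 * (Real.pi : ℂ)) * C)) *
    (-Complex.I_mul_I)

/-! ### Bloch vectors and the form `𝒜_k`. -/

/-- The pairing of the spatial part of a Bloch vector with the (unnormalized) rotation axis of
`su2 p r`. -/
def axisForm (p r : ℂ) (b : Fin 4 → ℂ) : ℂ :=
  -(r.im * b 1) - r.re * b 2 - p.im * b 3

theorem blochVec_apply (O : Matrix (Fin 2) (Fin 2) ℂ) :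
    blochVec O = ![O 0 0 + O 1 1, O 0 1 + O 1 0, Complex.I * (O 0 1 - O 1 0), O 0 0 - O 1 1] := by
  funext i
  fin_cases i <;>
    simp [blochVec, pauli, Matrix.trace, Matrix.mul_apply, Fin.sum_univ_two] <;> ring

/-- The vector `sin θ • v` is the unnormalized rotation axis of `u`, with squared length `gap`, and
`N = sin² θ / gap`; so `N v vᵀ` is the projector onto the axis. -/
theorem sandwichA_eq {Θ : CoinParam → ℝ} (hΘ : 0 < Real.sin (Θ .theta)) (k : ℝ)
    (v w : Fin 4 → ℂ) :
    sandwichA k Θ v w = star (v 0) * w 0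
      + ((1 / gap (stepP k Θ) : ℝ) : ℂ) * (star (axisForm (stepP k Θ) (stepR k Θ) v)
        * axisForm (stepP k Θ) (stepR k Θ) w) := by
  have hg := (gap_stepP_pos hΘ k).ne'
  have hgc : (gap (stepP k Θ) : ℂ) ≠ 0 := by exact_mod_cast hg
  have hs : (Real.sin (Θ .theta) : ℂ) ≠ 0 := by exact_mod_cast hΘ.ne'
  rw [sandwichA, projA, normN, ← gap_stepP, Real.cot_eq_cos_div_sin]
  generalize hq : gap (stepP k Θ) = q at hg hgc
  clear hq
  rw [stepP_eq, stepR_eq]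
  generalize Real.sin (Θ .theta) = s at hs
  generalize Real.cos (Θ .theta) = c
  generalize Real.sin (k - Θ .alpha) = x
  generalize Real.cos (k - Θ .alpha) = y
  generalize Real.sin (k - Θ .beta) = z
  generalize Real.cos (k - Θ .beta) = a
  simp [axisForm, Matrix.mulVec, dotProduct, Fin.sum_univ_four]
  field_simp
  ring

/-- The pairing is `i Tr (A u† ∂u)`. Since `A u† = 1 - (Re p) u†` and `u† ∂u` is traceless, it
reduces to `i Tr (∂u)`. -/
theorem axisForm_blochVec_conjTranspose_mul {p r dp dr : ℂ}
    (h : Complex.normSq p + Complex.normSq r = 1)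
    (h' : (star p * dp + star r * dr).re = 0) :
    axisForm p r (blochVec ((su2 p r)ᴴ * su2 dp dr)) = Complex.I * ((2 * dp.re : ℝ) : ℂ) := by
  obtain ⟨a, b⟩ := p
  obtain ⟨c, d⟩ := r
  obtain ⟨a', b'⟩ := dp
  obtain ⟨c', d'⟩ := dr
  simp [Complex.normSq_apply] at h h'
  rw [blochVec_apply]
  apply Complex.ext <;>
    simp [axisForm, su2, Matrix.mul_apply, Fin.sum_univ_two, Matrix.conjTranspose_apply]
  · ring
  · linear_combination 2 * a' * h - 2 * a * h'

theorem trace_conjTranspose_mul {p r dp dr : ℂ}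
    (h' : (star p * dp + star r * dr).re = 0) :
    blochVec ((su2 p r)ᴴ * su2 dp dr) 0 = 0 := by
  obtain ⟨a, b⟩ := p
  obtain ⟨c, d⟩ := r
  obtain ⟨a', b'⟩ := dp
  obtain ⟨c', d'⟩ := dr
  simp at h'
  rw [blochVec_apply]
  apply Complex.ext <;>
    simp [su2, Matrix.mul_apply, Fin.sum_univ_two, Matrix.conjTranspose_apply]
  · linear_combination 2 * h'
  · ring

/-- The pairing is `i` times the expectation of `A`, itself `i` times `expIm`. -/
theorem axisForm_blochVec_vecMulVec (p r : ℂ) (v : Fin 2 → ℂ) :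
    axisForm p r (blochVec (Matrix.vecMulVec v (star v))) = ((-expIm p r v : ℝ) : ℂ) := by
  obtain ⟨a, b⟩ := p
  obtain ⟨c, d⟩ := r
  rw [blochVec_apply]
  apply Complex.ext <;>
    simp [axisForm, expIm, su2, Matrix.vecMulVec_apply, Matrix.mulVec, dotProduct,
      Fin.sum_univ_two] <;> ring

theorem genO_eq (k : ℝ) (Θ : CoinParam → ℝ) (μ : CoinParam) :
    genO k Θ μ = (su2 (stepP k Θ) (stepR k Θ))ᴴ * su2 (stepP' k Θ μ) (stepR' k Θ μ) := by
  rw [genO, momentumStep_eq, momentumStepDeriv_eq]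

theorem independentTerm_eq {Θ : CoinParam → ℝ} (hΘ : 0 < Real.sin (Θ .theta))
    (μ ν : CoinParam) :
    independentTerm Θ μ ν = ((4 * meanVelocityProd Θ μ ν : ℝ) : ℂ) := by
  have e (k : ℝ) : sandwichA k Θ (blochVec (genO k Θ μ)) (blochVec (genO k Θ ν))
      = 4 * (((stepP' k Θ μ).re * (stepP' k Θ ν).re / gap (stepP k Θ) : ℝ) : ℂ) := by
    rw [sandwichA_eq hΘ, genO_eq, genO_eq, trace_conjTranspose_mul (step_orthogonal k Θ ν),
      axisForm_blochVec_conjTranspose_mul (normSq_step k Θ) (step_orthogonal k Θ μ),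
      axisForm_blochVec_conjTranspose_mul (normSq_step k Θ) (step_orthogonal k Θ ν)]
    simp
    linear_combination (-4 * ((stepP' k Θ μ).re : ℂ) * (stepP' k Θ ν).re / gap (stepP k Θ))
      * Complex.I_mul_I
  simp only [independentTerm, e, intervalIntegral.integral_const_mul,
    intervalIntegral.integral_ofReal, meanVelocityProd]
  push_cast
  ring

theorem dependentTerm_eq {Θ : CoinParam → ℝ} (hΘ : 0 < Real.sin (Θ .theta)) (Ψ₀ : WalkSpace)
    (μ ν : CoinParam) :
    dependentTerm Ψ₀ Θ μ ν = ((4 * (meanVelocity Ψ₀ Θ μ * meanVelocity Ψ₀ Θ ν) : ℝ) : ℂ) := by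
  have e1 (k : ℝ) : sandwichA k Θ (blochVec (genO k Θ μ)) (blochVec (initialRho Ψ₀ k))
      = (2 * Complex.I) * (((stepP' k Θ μ).re / gap (stepP k Θ)
        * expIm (stepP k Θ) (stepR k Θ) (momentumAmp Ψ₀ k) : ℝ) : ℂ) := by
    rw [sandwichA_eq hΘ, genO_eq, initialRho, trace_conjTranspose_mul (step_orthogonal k Θ μ),
      axisForm_blochVec_conjTranspose_mul (normSq_step k Θ) (step_orthogonal k Θ μ),
      axisForm_blochVec_vecMulVec]
    simp
    ring
  have e2 (k : ℝ) : sandwichA k Θ (blochVec (initialRho Ψ₀ k)) (blochVec (genO k Θ ν))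
      = (-2 * Complex.I) * (((stepP' k Θ ν).re / gap (stepP k Θ)
        * expIm (stepP k Θ) (stepR k Θ) (momentumAmp Ψ₀ k) : ℝ) : ℂ) := by
    rw [sandwichA_eq hΘ, genO_eq, initialRho, trace_conjTranspose_mul (step_orthogonal k Θ ν),
      axisForm_blochVec_conjTranspose_mul (normSq_step k Θ) (step_orthogonal k Θ ν),
      axisForm_blochVec_vecMulVec]
    simp
    ring
  simp only [dependentTerm, e1, e2, intervalIntegral.integral_const_mul,
    intervalIntegral.integral_ofReal, meanVelocity]
  generalize (∫ k in (-Real.pi)..Real.pi, (stepP' k Θ μ).re / gap (stepP k Θ)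
    * expIm (stepP k Θ) (stepR k Θ) (momentumAmp Ψ₀ k)) = B
  generalize (∫ k in (-Real.pi)..Real.pi, (stepP' k Θ ν).re / gap (stepP k Θ)
    * expIm (stepP k Θ) (stepR k Θ) (momentumAmp Ψ₀ k)) = C
  push_cast
  linear_combination (-4 * (1 / (2 * (Real.pi : ℂ)) * B) * (1 / (2 * (Real.pi : ℂ)) * C)) *
    Complex.I_mul_I

/-! ### Integrals over the Brillouin zone. -/

section Integrals

variable {s c : ℝ}

theorem one_sub_cos_sq_mul_pos (hs : 0 < s) (h : s ^ 2 + c ^ 2 = 1) (x : ℝ) :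
    0 < 1 - c ^ 2 * Real.cos x ^ 2 := by
  nlinarith [Real.cos_sq_le_one x, sq_nonneg c, pow_pos hs 2]

theorem continuous_div_one_sub_cos_sq (hs : 0 < s) (h : s ^ 2 + c ^ 2 = 1) (a : ℝ) {f : ℝ → ℝ}
    (hf : Continuous f) : Continuous fun k => f k / (1 - c ^ 2 * Real.cos (k - a) ^ 2) :=
  hf.div (by fun_prop) fun k => (one_sub_cos_sq_mul_pos hs h (k - a)).ne'

/-- The usual primitive `arctan (tan x / s) / s` jumps at odd multiples of `π / 2`. Subtracting `x`
from the arctangent by the addition formula gives the argument used here, whose denominator never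
vanishes, so this primitive is smooth on the whole line. -/
theorem hasDerivAt_arctan_primitive (hs : 0 < s) (h : s ^ 2 + c ^ 2 = 1) (x : ℝ) :
    HasDerivAt (fun x => (x + Real.arctan ((1 - s) * (Real.sin x * Real.cos x)
      / (Real.sin x ^ 2 + s * Real.cos x ^ 2))) / s)
      (1 / (1 - c ^ 2 * Real.cos x ^ 2)) x := by
  have hden : 0 < Real.sin x ^ 2 + s * Real.cos x ^ 2 := by
    rcases eq_or_ne (Real.sin x) 0 with h0 | h0
    · have := Real.sin_sq_add_cos_sq x
      rw [h0] at this ⊢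
      nlinarith
    · have := sq_nonneg (Real.cos x)
      positivity
  have hq := one_sub_cos_sq_mul_pos hs h x
  have hsin := Real.hasDerivAt_sin x
  have hcos := Real.hasDerivAt_cos x
  have hd := (((hasDerivAt_id' x).fun_add ((((hsin.fun_mul hcos).const_mul (1 - s)).fun_div
    ((hsin.fun_pow 2).fun_add ((hcos.fun_pow 2).const_mul s)) hden.ne').arctan)).div_const s)
  refine hd.congr_deriv ?_
  clear hd
  have e1 := Real.sin_sq_add_cos_sq x
  have hq' : 1 - c ^ 2 * Real.cos x ^ 2 = Real.sin x ^ 2 + s ^ 2 * Real.cos x ^ 2 := by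
    linear_combination (-Real.cos x ^ 2) * h - e1
  rw [hq'] at hq ⊢
  generalize Real.sin x = S at *
  generalize Real.cos x = C at *
  have key : 1 + ((1 - s) * (S * C) / (S ^ 2 + s * C ^ 2)) ^ 2
      = (S ^ 2 + s ^ 2 * C ^ 2) / (S ^ 2 + s * C ^ 2) ^ 2 := by
    rw [div_pow, eq_div_iff (by positivity), add_mul, div_mul_cancel₀ _ (by positivity)]
    linear_combination (S ^ 2 + s ^ 2 * C ^ 2) * e1
  rw [key]
  have hq0 := hq.ne'
  have hd0 := hden.ne'
  have hs0 := hs.ne'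
  field_simp
  push_cast
  simp only [pow_one]
  linear_combination ((1 - s) * (s * C ^ 2 - S ^ 2) + s) * e1

/-- The arctangent term is `2π`-periodic, so only the linear term `x / s` contributes. -/
theorem integral_one_div_one_sub_cos_sq (hs : 0 < s) (h : s ^ 2 + c ^ 2 = 1) (a : ℝ) :
    ∫ k in (-Real.pi)..Real.pi, 1 / (1 - c ^ 2 * Real.cos (k - a) ^ 2) = 2 * Real.pi / s := by
  rw [intervalIntegral.integral_eq_sub_of_hasDerivAt
    (fun k _ => (hasDerivAt_arctan_primitive hs h (k - a)).comp_sub_const k a)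
    ((continuous_div_one_sub_cos_sq hs h a continuous_const).intervalIntegrable _ _)]
  have e1 : Real.sin (-Real.pi - a) = Real.sin (Real.pi - a) := by
    rw [show Real.pi - a = -Real.pi - a + 2 * Real.pi by ring, Real.sin_add_two_pi]
  have e2 : Real.cos (-Real.pi - a) = Real.cos (Real.pi - a) := by
    rw [show Real.pi - a = -Real.pi - a + 2 * Real.pi by ring, Real.cos_add_two_pi]
  rw [e1, e2]
  ring

theorem integral_sin_sq_div (hs : 0 < s) (h : s ^ 2 + c ^ 2 = 1) (a : ℝ) :
    ∫ k in (-Real.pi)..Real.pi, (Real.sin (k - a) * c) * (Real.sin (k - a) * c)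
      / (1 - c ^ 2 * Real.cos (k - a) ^ 2) = 2 * Real.pi * (1 - s) := by
  have e (k : ℝ) : (Real.sin (k - a) * c) * (Real.sin (k - a) * c)
      / (1 - c ^ 2 * Real.cos (k - a) ^ 2)
      = 1 - s ^ 2 * (1 / (1 - c ^ 2 * Real.cos (k - a) ^ 2)) := by
    have := (one_sub_cos_sq_mul_pos hs h (k - a)).ne'
    field_simp
    linear_combination c ^ 2 * Real.sin_sq_add_cos_sq (k - a) + h
  simp only [e]
  rw [intervalIntegral.integral_sub (by simp)
    (((continuous_div_one_sub_cos_sq hs h a continuous_const).intervalIntegrable _ _).const_mul _),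
    intervalIntegral.integral_const_mul, integral_one_div_one_sub_cos_sq hs h]
  simp
  field_simp
  ring

theorem integral_cos_sq_div (hs : 0 < s) (h : s ^ 2 + c ^ 2 = 1) (a : ℝ) :
    ∫ k in (-Real.pi)..Real.pi, -(Real.cos (k - a) * s) * -(Real.cos (k - a) * s)
      / (1 - c ^ 2 * Real.cos (k - a) ^ 2) = 2 * Real.pi * (s / (1 + s)) := by
  -- The reduction to the previous integral divides by `c ^ 2`; for `c = 0` the integrand is just
  -- `cos²`.
  rcases eq_or_ne c 0 with rfl | hc
  · have hs1 : s = 1 := by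
      have : s ^ 2 = 1 := by linarith
      exact (pow_eq_one_iff_of_nonneg hs.le two_ne_zero).mp this
    subst hs1
    have e (k : ℝ) : -(Real.cos (k - a) * 1) * -(Real.cos (k - a) * 1)
      / (1 - 0 ^ 2 * Real.cos (k - a) ^ 2) = Real.cos (k - a) ^ 2 := by ring
    simp only [e]
    rw [intervalIntegral.integral_comp_sub_right (fun x => Real.cos x ^ 2) a, integral_cos_sq]
    have e1 : Real.sin (-Real.pi - a) = Real.sin (Real.pi - a) := by
      rw [show Real.pi - a = -Real.pi - a + 2 * Real.pi by ring, Real.sin_add_two_pi]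
    have e2 : Real.cos (-Real.pi - a) = Real.cos (Real.pi - a) := by
      rw [show Real.pi - a = -Real.pi - a + 2 * Real.pi by ring, Real.cos_add_two_pi]
    rw [e1, e2]
    ring
  · have e (k : ℝ) : -(Real.cos (k - a) * s) * -(Real.cos (k - a) * s)
        / (1 - c ^ 2 * Real.cos (k - a) ^ 2)
        = s ^ 2 / c ^ 2 * (1 / (1 - c ^ 2 * Real.cos (k - a) ^ 2)) - s ^ 2 / c ^ 2 := by
      have := (one_sub_cos_sq_mul_pos hs h (k - a)).ne'
      rw [div_eq_iff this, sub_mul, mul_assoc, one_div_mul_cancel this]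
      field_simp
      ring
    simp only [e]
    rw [intervalIntegral.integral_sub
      (((continuous_div_one_sub_cos_sq hs h a continuous_const).intervalIntegrable _ _).const_mul _)
      (by simp), intervalIntegral.integral_const_mul, integral_one_div_one_sub_cos_sq hs h]
    have hs1 : 1 + s ≠ 0 := by positivity
    simp
    field_simp
    linear_combination (-2) * h

/-- For `c ≠ 0` the integrand is a multiple of the logarithmic derivative of the periodic
denominator. -/
theorem integral_sin_mul_cos_div (hs : 0 < s) (h : s ^ 2 + c ^ 2 = 1) (a : ℝ) :
    ∫ k in (-Real.pi)..Real.pi, -(Real.cos (k - a) * s) * (Real.sin (k - a) * c)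
      / (1 - c ^ 2 * Real.cos (k - a) ^ 2) = 0 := by
  rcases eq_or_ne c 0 with rfl | hc
  · simp
  have hd (k : ℝ) : HasDerivAt (fun k => -(s / (2 * c)) *
      Real.log (1 - c ^ 2 * Real.cos (k - a) ^ 2))
      (-(Real.cos (k - a) * s) * (Real.sin (k - a) * c)
      / (1 - c ^ 2 * Real.cos (k - a) ^ 2)) k := by
    have hq := (one_sub_cos_sq_mul_pos hs h (k - a)).ne'
    have h1 := (((((Real.hasDerivAt_cos (k - a)).comp_sub_const k a).fun_pow 2).const_mul
      (c ^ 2)).const_sub 1).log hq |>.const_mul (-(s / (2 * c)))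
    refine h1.congr_deriv ?_
    push_cast
    field_simp
  rw [intervalIntegral.integral_eq_sub_of_hasDerivAt (fun k _ => hd k)
    ((continuous_div_one_sub_cos_sq hs h a (by fun_prop)).intervalIntegrable _ _)]
  have e2 : Real.cos (-Real.pi - a) = Real.cos (Real.pi - a) := by
    rw [show Real.pi - a = -Real.pi - a + 2 * Real.pi by ring, Real.cos_add_two_pi]
  rw [e2, sub_self]

end Integrals

/-! ### Values of the means. -/

theorem stepP'_theta_re (k : ℝ) (Θ : CoinParam → ℝ) :
    (stepP' k Θ .theta).re = -(Real.cos (k - Θ .alpha) * Real.sin (Θ .theta)) := by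
  rw [stepP'_theta_eq]

theorem stepP'_alpha_re (k : ℝ) (Θ : CoinParam → ℝ) :
    (stepP' k Θ .alpha).re = Real.sin (k - Θ .alpha) * Real.cos (Θ .theta) := by
  rw [stepP', stepP_eq]
  simp

theorem stepP'_beta (k : ℝ) (Θ : CoinParam → ℝ) : stepP' k Θ .beta = 0 := rfl

theorem meanVelocityProd_comm (Θ : CoinParam → ℝ) (μ ν : CoinParam) :
    meanVelocityProd Θ μ ν = meanVelocityProd Θ ν μ := by
  simp only [meanVelocityProd, mul_comm (stepP' _ Θ μ).re]

/-- The quasi-energy satisfies `cos ω = cos θ cos (k - α)` and so does not see `β`; the parameter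
only rotates the axis. -/
theorem meanVelocityProd_beta (Θ : CoinParam → ℝ) (μ : CoinParam) :
    meanVelocityProd Θ μ .beta = 0 := by
  simp [meanVelocityProd, stepP'_beta]

theorem meanVelocity_beta (Ψ₀ : WalkSpace) (Θ : CoinParam → ℝ) :
    meanVelocity Ψ₀ Θ .beta = 0 := by
  simp [meanVelocity, stepP'_beta]

theorem meanVelocityProd_theta {Θ : CoinParam → ℝ} (hΘ : 0 < Real.sin (Θ .theta)) :
    meanVelocityProd Θ .theta .theta
      = Real.sin (Θ .theta) / (1 + Real.sin (Θ .theta)) := by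
  simp only [meanVelocityProd, stepP'_theta_re, gap_stepP]
  rw [integral_cos_sq_div hΘ (Real.sin_sq_add_cos_sq _)]
  have := Real.pi_ne_zero
  field_simp

theorem meanVelocityProd_alpha {Θ : CoinParam → ℝ} (hΘ : 0 < Real.sin (Θ .theta)) :
    meanVelocityProd Θ .alpha .alpha = 1 - Real.sin (Θ .theta) := by
  simp only [meanVelocityProd, stepP'_alpha_re, gap_stepP]
  rw [integral_sin_sq_div hΘ (Real.sin_sq_add_cos_sq _)]
  have := Real.pi_ne_zero
  field_simp

theorem meanVelocityProd_theta_alpha {Θ : CoinParam → ℝ} (hΘ : 0 < Real.sin (Θ .theta)) :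
    meanVelocityProd Θ .theta .alpha = 0 := by
  simp only [meanVelocityProd, stepP'_theta_re, stepP'_alpha_re, gap_stepP]
  rw [integral_sin_mul_cos_div hΘ (Real.sin_sq_add_cos_sq _), mul_zero]

theorem meanVelocityProd_of_ne {Θ : CoinParam → ℝ} (hΘ : 0 < Real.sin (Θ .theta))
    {μ ν : CoinParam} (h : μ ≠ ν) : meanVelocityProd Θ μ ν = 0 := by
  cases μ <;> cases ν <;> first
    | exact absurd rfl h
    | exact meanVelocityProd_beta _ _
    | exact meanVelocityProd_theta_alpha hΘ
    | (rw [meanVelocityProd_comm]; first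
        | exact meanVelocityProd_beta _ _
        | exact meanVelocityProd_theta_alpha hΘ)

/-! ### An optimal initial state and the extremal property. -/

/-- The state with `φ_k = (1, e^{i (k - β)}) / √2`, which is unpolarized along the rotation axis
of the evolution at every momentum. -/
def unpolarizedState (b : ℝ) : WalkSpace :=
  lp.single 2 ((0, 0) : ℤ × Fin 2) (((Real.sqrt 2)⁻¹ : ℝ) : ℂ)
    + lp.single 2 ((-1, 1) : ℤ × Fin 2)
      ((((Real.sqrt 2)⁻¹ : ℝ) : ℂ) * Complex.exp (-(Complex.I * b)))

theorem momentumAmp_unpolarizedState (b : ℝ) :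
    ∀ᵐ k ∂bzMeasure, momentumAmp (unpolarizedState b) k
      = ![(((Real.sqrt 2)⁻¹ : ℝ) : ℂ),
        (((Real.sqrt 2)⁻¹ : ℝ) : ℂ) * Complex.exp (Complex.I * (k - b))] := by
  have h0 : momentumLp (unpolarizedState b) 0 = (((Real.sqrt 2)⁻¹ : ℝ) : ℂ) • fourierLp 2 0 := by
    rw [momentumLp, tsum_eq_single 0]
    · simp [unpolarizedState, lp.single_apply]
    · intro x hx
      simp [unpolarizedState, lp.single_apply, hx]
  have h1 : momentumLp (unpolarizedState b) 1
      = ((((Real.sqrt 2)⁻¹ : ℝ) : ℂ) * Complex.exp (-(Complex.I * b))) • fourierLp 2 1 := by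
    rw [momentumLp, tsum_eq_single (-1)]
    · simp [unpolarizedState, lp.single_apply]
    · intro x hx
      simp [unpolarizedState, lp.single_apply, hx]
  filter_upwards [quasiMeasurePreserving_coe.ae (Lp.coeFn_smul (((Real.sqrt 2)⁻¹ : ℝ) : ℂ)
      (fourierLp (T := 2 * Real.pi) 2 0)),
    quasiMeasurePreserving_coe.ae (Lp.coeFn_smul
      ((((Real.sqrt 2)⁻¹ : ℝ) : ℂ) * Complex.exp (-(Complex.I * b)))
      (fourierLp (T := 2 * Real.pi) 2 1)),
    quasiMeasurePreserving_coe.ae (coeFn_fourierLp (T := 2 * Real.pi) 2 0),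
    quasiMeasurePreserving_coe.ae (coeFn_fourierLp (T := 2 * Real.pi) 2 1)] with k a1 a2 a3 a4
  funext j
  fin_cases j
  · simp only [momentumAmp, Fin.zero_eta, h0]
    rw [a1, Pi.smul_apply, a3, fourier_coe_two_pi]
    simp
  · simp only [momentumAmp, Fin.mk_one, h1]
    rw [a2, Pi.smul_apply, a4, fourier_coe_two_pi, smul_eq_mul, mul_assoc, ← Complex.exp_add]
    simp only [Matrix.cons_val_one, Matrix.cons_val_fin_one]
    congr 2
    push_cast
    ring

theorem hasUnitMomentumAmp_unpolarizedState (b : ℝ) :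
    HasUnitMomentumAmp (unpolarizedState b) := by
  rw [HasUnitMomentumAmp, ← restrict_Ioc_eq_restrict_Icc]
  filter_upwards [momentumAmp_unpolarizedState b] with k hk
  rw [hk, Fin.sum_univ_two]
  simp only [Matrix.cons_val_zero, Matrix.cons_val_one, Matrix.cons_val_fin_one, norm_mul]
  rw [Complex.norm_real, Complex.norm_exp]
  simp
  norm_num

/-- The Bloch vector `(cos (k - β), sin (k - β), 0)` is orthogonal to the axis for every `k`, so the
integrand vanishes pointwise. Neither `θ` nor `α` enters the state, and it is optimal for both at
once. -/
theorem meanVelocity_unpolarizedState (Θ : CoinParam → ℝ) (μ : CoinParam) :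
    meanVelocity (unpolarizedState (Θ .beta)) Θ μ = 0 := by
  have hpi : -Real.pi ≤ Real.pi := by linarith [Real.pi_pos]
  rw [meanVelocity, intervalIntegral.integral_of_le hpi]
  refine mul_eq_zero_of_right _ (integral_eq_zero_of_ae ?_)
  filter_upwards [momentumAmp_unpolarizedState (Θ .beta)] with k hk
  refine mul_eq_zero_of_right _ ?_
  have e : Complex.exp (Complex.I * (k - Θ .beta))
      = ⟨Real.cos (k - Θ .beta), Real.sin (k - Θ .beta)⟩ := by
    rw [← Complex.ofReal_sub, ← star_exp_neg_I_mul, exp_neg_I_mul_eq]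
    apply Complex.ext <;> simp
  rw [hk, e, expIm, stepR_eq, stepP_eq]
  simp [su2, Matrix.mulVec, dotProduct, Fin.sum_univ_two, -mul_inv_rev]
  linear_combination ((√2 / 2) ^ 2 * Real.sin (k - Θ .alpha) * Real.cos (Θ .theta)) *
    Real.sin_sq_add_cos_sq (k - Θ .beta)

theorem isGreatest_leadingQFI {Θ : CoinParam → ℝ} (hΘ : 0 < Real.sin (Θ .theta))
    (μ : CoinParam) :
    IsGreatest {L : ℝ | ∃ Ψ₀ : WalkSpace, HasUnitMomentumAmp Ψ₀ ∧ HasLeadingQFI Ψ₀ Θ μ μ L}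
      (4 * meanVelocityProd Θ μ μ) := by
  constructor
  · have hu := hasUnitMomentumAmp_unpolarizedState (Θ .beta)
    refine ⟨_, hu, ?_⟩
    have h := hasLeadingQFI hΘ hu μ μ
    rwa [meanVelocity_unpolarizedState, zero_mul, sub_zero] at h
  · rintro L ⟨Ψ₀, hu, hL⟩
    rw [tendsto_nhds_unique hL (hasLeadingQFI hΘ hu μ μ)]
    nlinarith [mul_self_nonneg (meanVelocity Ψ₀ Θ μ)]

/-- By uniqueness of limits the defect from the maximum is `4 m_μ²`. -/
theorem hasLeadingQFI_max_iff {Θ : CoinParam → ℝ} (hΘ : 0 < Real.sin (Θ .theta))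
    {Ψ₀ : WalkSpace} (hu : HasUnitMomentumAmp Ψ₀) (μ : CoinParam) :
    HasLeadingQFI Ψ₀ Θ μ μ (4 * meanVelocityProd Θ μ μ) ↔ meanVelocity Ψ₀ Θ μ = 0 := by
  have h := hasLeadingQFI hΘ hu μ μ
  constructor
  · intro hL
    have := tendsto_nhds_unique hL h
    exact mul_self_eq_zero.mp (by linarith)
  · intro h0
    rwa [h0, zero_mul, sub_zero] at h

theorem dependentTerm_self_eq_zero_iff {Θ : CoinParam → ℝ} (hΘ : 0 < Real.sin (Θ .theta))
    (Ψ₀ : WalkSpace) (μ : CoinParam) :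
    dependentTerm Ψ₀ Θ μ μ = 0 ↔ meanVelocity Ψ₀ Θ μ = 0 := by
  rw [dependentTerm_eq hΘ, Complex.ofReal_eq_zero]
  simp

/-- An off-diagonal coefficient is `-4 m_μ m_ν`. Entries with `β` vanish since `m_β = 0`, and the
`θ`–`α` entry needs only one zero factor. -/
theorem hasLeadingQFI_zero_of_ne {Θ : CoinParam → ℝ} (hΘ : 0 < Real.sin (Θ .theta))
    {Ψ₀ : WalkSpace} (hu : HasUnitMomentumAmp Ψ₀)
    (h : meanVelocity Ψ₀ Θ .theta = 0 ∨ meanVelocity Ψ₀ Θ .alpha = 0) {μ ν : CoinParam}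
    (hne : μ ≠ ν) : HasLeadingQFI Ψ₀ Θ μ ν 0 := by
  have hb := meanVelocity_beta Ψ₀ Θ
  have hprod : meanVelocity Ψ₀ Θ μ * meanVelocity Ψ₀ Θ ν = 0 := by
    rcases h with h | h <;> cases μ <;> cases ν <;> simp_all
  have := hasLeadingQFI hΘ hu μ ν
  rwa [meanVelocityProd_of_ne hΘ hne, hprod, sub_zero, mul_zero] at this

end QuantumWalk

end

/-! ### The main theorem. -/

open QuantumWalk in
theorem corollary2 (Θ : CoinParam → ℝ) (hΘ : 0 < Real.sin (Θ .theta)) :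
    let maxTheta : ℝ := 4 * Real.sin (Θ .theta) / (1 + Real.sin (Θ .theta))
    let maxAlpha : ℝ := 4 * (1 - Real.sin (Θ .theta))
    -- the initial-state independent integrals
    independentTerm Θ .theta .theta = (maxTheta : ℂ) ∧
    independentTerm Θ .alpha .alpha = (maxAlpha : ℂ) ∧
    (∀ μ ν : CoinParam, μ ≠ ν → independentTerm Θ μ ν = 0) ∧
    -- the quantum Fisher information matrix for an arbitrary initial state
    (∀ Ψ₀ : WalkSpace, HasUnitMomentumAmp Ψ₀ →
      (∀ (t : ℕ) (μ : CoinParam), DifferentiableAt ℝ (walkCurve Ψ₀ t Θ μ) (Θ μ)) ∧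
      (∃ L : ℝ, L ≤ maxTheta ∧ HasLeadingQFI Ψ₀ Θ .theta .theta L) ∧
      (∃ L : ℝ, L ≤ maxAlpha ∧ HasLeadingQFI Ψ₀ Θ .alpha .alpha L) ∧
      (dependentTerm Ψ₀ Θ .theta .theta = 0 → HasLeadingQFI Ψ₀ Θ .theta .theta maxTheta) ∧
      (dependentTerm Ψ₀ Θ .alpha .alpha = 0 → HasLeadingQFI Ψ₀ Θ .alpha .alpha maxAlpha) ∧
      (HasLeadingQFI Ψ₀ Θ .theta .theta maxTheta ∨ HasLeadingQFI Ψ₀ Θ .alpha .alpha maxAlpha →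
        ∀ μ ν : CoinParam, μ ≠ ν → HasLeadingQFI Ψ₀ Θ μ ν 0)) ∧
    -- the bounds are maxima: they are attained
    IsGreatest {L : ℝ | ∃ Ψ₀ : WalkSpace, HasUnitMomentumAmp Ψ₀ ∧
      HasLeadingQFI Ψ₀ Θ .theta .theta L} maxTheta ∧
    IsGreatest {L : ℝ | ∃ Ψ₀ : WalkSpace, HasUnitMomentumAmp Ψ₀ ∧
      HasLeadingQFI Ψ₀ Θ .alpha .alpha L} maxAlpha := by
  intro maxTheta maxAlpha
  have hT : 4 * meanVelocityProd Θ .theta .theta = maxTheta := by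
    rw [meanVelocityProd_theta hΘ, mul_div_assoc']
  have hA : 4 * meanVelocityProd Θ .alpha .alpha = maxAlpha := by
    rw [meanVelocityProd_alpha hΘ]
  have hle (Ψ₀ : WalkSpace) (hu : HasUnitMomentumAmp Ψ₀) (μ : CoinParam) :
      ∃ L ≤ 4 * meanVelocityProd Θ μ μ, HasLeadingQFI Ψ₀ Θ μ μ L :=
    have h := hasLeadingQFI hΘ hu μ μ
    ⟨_, (isGreatest_leadingQFI hΘ μ).2 ⟨Ψ₀, hu, h⟩, h⟩
  rw [← hT, ← hA]
  refine ⟨independentTerm_eq hΘ _ _, independentTerm_eq hΘ _ _, fun μ ν h => ?_,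
    fun Ψ₀ hu => ⟨differentiableAt_walkCurve hΘ Ψ₀, hle Ψ₀ hu _, hle Ψ₀ hu _, ?_, ?_, ?_⟩,
    isGreatest_leadingQFI hΘ _, isGreatest_leadingQFI hΘ _⟩
  · rw [independentTerm_eq hΘ, meanVelocityProd_of_ne hΘ h, mul_zero, Complex.ofReal_zero]
  · rw [dependentTerm_self_eq_zero_iff hΘ, hasLeadingQFI_max_iff hΘ hu]
    exact id
  · rw [dependentTerm_self_eq_zero_iff hΘ, hasLeadingQFI_max_iff hΘ hu]
    exact id
  · rw [hasLeadingQFI_max_iff hΘ hu, hasLeadingQFI_max_iff hΘ hu]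
    exact fun h μ ν hne => hasLeadingQFI_zero_of_ne hΘ hu h hne
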